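/- Let $n\ge 1$, let $G$ be a (finite-dimensional real) Lie group with Lie algebra $\mathfrak g$ acting smoothly on a smooth manifold $M$, and for $x\in\mathfrak g$ let $v_x$ be the corresponding infinitesimal generator, $v_x(p)=\frac{d}{dt}\big|_{t=0}\exp(-tx)\cdot p$. Write $\iota(v_1\wedge\dots\wedge v_k)\sigma=\sigma(v_1,\dots,v_k,\cdot,\dots,\cdot)$ and $\varsigma(k)=-(-1)^{k(k+1)/2}$. For $F$ in $\wedge^{k-1}\mathfrak g^*\otimes\Omega(M)$ let $$(d_{\mathfrak g}F)(x_1,\dots,x_k)=\sum_{1\le i<j\le k}(-1)^{i+j}F([x_i,x_j],x_1,\dots,\widehat{x_i},\dots,\widehat{x_j},\dots,x_k)$$ be the Chevalley–Eilenberg differential, and let $d$ be the de Rham differential. For a $G$-invariant closed form $\omega\in\Omega^{n+1}(M)$, a homotopy moment map for $\omega$ is a family $f$ of alternating multilinear maps $f_k:\wedge^k\mathfrak g\to\Omega^{n-k}(M)$, $k=1,\dots,n$, such that $d(f_1(x))=-\iota(v_x)\omega$ for all $x \in \mathfrak g$, $$-(d_{\mathfrak g}f_{k-1})(x_1,\dots,x_k)=d\,f_k(x_1,\dots,x_k)+\varsigma(k)\,\iota(v_{x_1}\wedge\dots\wedge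 v_{x_k})\omega\qquad(2\le k\le n)$$ and $$-(d_{\mathfrak g}f_n)(x_1,\dots,x_{n+1})=\varsigma(n+1)\,\iota(v_{x_1}\wedge\dots\wedge v_{x_{n+1}})\omega .$$ Let $\varphi=\varphi_1+\dots+\varphi_n$ with $\varphi_k=\varsigma(k)f_k$. On $\wedge^{\ge1}\mathfrak g^*\otimes\Omega(M)$, graded by total degree, let $d_{tot}=d_{\mathfrak g}+(-1)^kd$ on $\wedge^k\mathfrak g^*\otimes\Omega(M)$. For a $G$-invariant form $\alpha\in\Omega^n(M)$ put $\widetilde\alpha=\sum_{k=1}^n(-1)^{k-1}\alpha_k$, where $\alpha_k(x_1,\dots,x_k)=\iota(v_{x_1}\wedge\dots\wedge v_{x_k})\alpha$. Two pairs $(\omega,f)$ and $(\omega',f')$ as above, with corresponding elements $\varphi$ and $\varphi'$, are equivalent if there are $\eta\in(\wedge^{\ge1}\mathfrak g^*\otimes\Omega(M))_{n-1}$ and a $G$-invariant $\alpha\in\Omega^n(M)$ with $$\omega'-\omega=d\alpha,\qquad \varphi'-\varphi=d_{tot}\eta+\widetilde\alpha .$$ Proposition. Let $\omega^0,\omega^1$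 be closed $(n+1)$-forms on $M$ preserved by the action of $G$. Suppose that there is a $G$-equivariant diffeomorphism $\psi$ of $M$, isotopic to $\mathrm{Id}_M$ through $G$-equivariant diffeomorphisms (that is, by a family $(\psi_s)_{s\in[0,1]}$ of such diffeomorphisms, smooth on $[0,1]\times M$, with $\psi_0=\mathrm{Id}_M$ and $\psi_1=\psi$), such that $\psi^*\omega^1=\omega^0$. Let $f^0$ and $f^1$ be homotopy moment maps for $\omega^0$ and $\omega^1$ that are intertwined by $\psi$, that is, $\psi^*f^1_k=f^0_k$ for $k=1,\dots,n$. Then $(\omega^0,f^0)$ and $(\omega^1,f^1)$ are equivalent. -/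

import Mathlib

open scoped Manifold ContDiff

noncomputable section

namespace HomotopyMoment

/-! ### Differential forms on a manifold -/

section Forms

variable {E : Type*} [NormedAddCommGroup E] [NormedSpace ℝ E]
  {E' : Type*} [NormedAddCommGroup E'] [NormedSpace ℝ E']
  {M : Type*} [TopologicalSpace M] [ChartedSpace E M]
  {M' : Type*} [TopologicalSpace M'] [ChartedSpace E' M']

/-- A vector field on `M`, with no regularity required: a tangent vector at every point. -/
abbrev VField (E : Type*) [NormedAddCommGroup E] [NormedSpace ℝ E]
    (M : Type*) [TopologicalSpace M] [ChartedSpace E M] : Type _ :=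
  ∀ p : M, TangentSpace 𝓘(ℝ, E) p

/-- A `k`-form on `M`, with no regularity required: an alternating `k`-linear form on the tangent
space at every point. -/
abbrev FormField (E : Type*) [NormedAddCommGroup E] [NormedSpace ℝ E]
    (M : Type*) [TopologicalSpace M] [ChartedSpace E M] (k : ℕ) : Type _ :=
  ∀ p : M, TangentSpace 𝓘(ℝ, E) p [⋀^Fin k]→L[ℝ] ℝ

/-- The pullback `F^*σ`, i.e. `(F^*σ)_p (w₁, …, w_k) = σ_{F p} (dF_p w₁, …, dF_p w_k)`. -/
def pullback {k : ℕ} (F : M → M') (σ : FormField E' M' k) : FormField E M k :=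
  fun p => (σ (F p)).compContinuousLinearMap (mfderiv 𝓘(ℝ, E) 𝓘(ℝ, E') F p)

/-- The expression of `σ` in the chart around `p₀`: the pullback of `σ` by the inverse of the chart,
a form on the model space (meaningful on the target of the chart, which is open). -/
def inChart {k : ℕ} (p₀ : M) (σ : FormField E M k) : E → E [⋀^Fin k]→L[ℝ] ℝ :=
  pullback (E := E) (M := E) (extChartAt 𝓘(ℝ, E) p₀).symm σ

/-- A form is smooth if its expressions in the charts are smooth. -/
def IsSmoothForm {k : ℕ} (σ : FormField E M k) : Prop :=
  ∀ p₀ : M, ContDiffOn ℝ ∞ (inChart p₀ σ) (extChartAt 𝓘(ℝ, E) p₀).target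

/-- The exterior derivative: at `p`, it is computed in the chart around `p`. -/
def dForm {k : ℕ} (σ : FormField E M k) : FormField E M (k + 1) :=
  fun p => pullback (E' := E) (M' := E) (extChartAt 𝓘(ℝ, E) p)
    (extDeriv (inChart p σ)) p

/-- The space `Ω^k(M)` of smooth `k`-forms. -/
def Ω (E : Type*) [NormedAddCommGroup E] [NormedSpace ℝ E]
    (M : Type*) [TopologicalSpace M] [ChartedSpace E M] (k : ℕ) :
    Submodule ℝ (FormField E M k) where
  carrier := {σ | IsSmoothForm σ}
  zero_mem' := fun _ => contDiffOn_const (c := (0 : E [⋀^Fin k]→L[ℝ] ℝ))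
  add_mem' := fun ha hb p₀ => (ha p₀).add (hb p₀)
  smul_mem' := fun c _ ha p₀ => contDiffOn_const (c := c) |>.smul (ha p₀)

theorem append_update {V : Type*} {k m : ℕ} [DecidableEq (Fin m)] (v : Fin k → V) (w : Fin m → V)
    (i : Fin m) (z : V) :
    Fin.append v (Function.update w i z) =
      Function.update (Fin.append v w) (Fin.natAdd k i) z := by
  funext l
  refine Fin.addCases (fun a => ?_) (fun b => ?_) l
  · have : Fin.castAdd m a ≠ Fin.natAdd k i := by
      intro h
      have := congrArg Fin.val h
      simp at this
      omega
    simp [Function.update_of_ne this]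
  · by_cases hb : b = i
    · subst hb
      simp
    · have : Fin.natAdd k b ≠ Fin.natAdd k i := by
        intro h
        exact hb (by simpa [Fin.ext_iff] using h)
      simp [Function.update_of_ne this, Function.update_of_ne hb]

/-- The contraction `ι(v₁ ∧ ⋯ ∧ v_k) σ = ι_{v_k} ⋯ ι_{v₁} σ`, i.e. the form
`(w₁, …, w_m) ↦ σ (v₁, …, v_k, w₁, …, w_m)`. -/
def contract {k m N : ℕ} (h : k + m = N) (v : Fin k → VField E M) (σ : FormField E M N) :
    FormField E M m :=
  fun p =>
    { toFun := fun w => σ p (fun i => Fin.append (fun a => v a p) w (Fin.cast h.symm i))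
      map_update_add' := by
        intro _ w i x y
        subst h
        simp only [Fin.cast_refl, id]
        rw [append_update, append_update, append_update]
        convert (σ p).map_update_add _ _ x y
      map_update_smul' := by
        intro _ w i c x
        subst h
        simp only [Fin.cast_refl, id]
        rw [append_update, append_update]
        convert (σ p).map_update_smul _ _ c x
      map_eq_zero_of_eq' := by
        intro w i j hij hne
        subst h
        refine (σ p).map_eq_zero_of_eq _ (i := Fin.natAdd k i) (j := Fin.natAdd k j) ?_ ?_
        · simpa using hij
        · simpa [Fin.ext_iff] using hne
      cont := by
        subst h
        refine (σ p).cont.comp (continuous_pi fun i => ?_)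
        refine Fin.addCases (fun a => ?_) (fun b => ?_) i
        · simpa using continuous_const
        · simpa using continuous_apply b }

end Forms

/-! ### Lie group actions -/

section Actions

variable {E : Type*} [NormedAddCommGroup E] [NormedSpace ℝ E]
  {M : Type*} [TopologicalSpace M] [ChartedSpace E M]
  {EG : Type*} [NormedAddCommGroup EG] [NormedSpace ℝ EG]
  {G : Type*} [TopologicalSpace G] [ChartedSpace EG G] [Group G] [MulAction G M]

/-- The infinitesimal generator of a left action associated with `x` in the Lie algebra,
`v_x (p) = d/dt|₀ (exp (-t x) • p)`. The minus sign makes `x ↦ v_x` a homomorphism of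
Lie algebras, the Lie algebra of `G` being defined by left-invariant vector fields. -/
def infGen (x : GroupLieAlgebra 𝓘(ℝ, EG) G) : VField E M :=
  fun p => -(mfderiv 𝓘(ℝ, EG) 𝓘(ℝ, E) (fun g : G => g • p) 1 x)

variable (G) in
/-- `σ` is preserved by the action of `G`. -/
def IsInvariantForm {k : ℕ} (σ : FormField E M k) : Prop :=
  ∀ g : G, pullback (fun p : M => g • p) σ = σ

variable (G) in
/-- The diffeomorphism `ψ` commutes with the action of `G`. -/
def IsEquivariant (ψ : M ≃ₘ^∞⟮𝓘(ℝ, E), 𝓘(ℝ, E)⟯ M) : Prop :=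
  ∀ (g : G) (p : M), ψ (g • p) = g • ψ p

variable (G) in
/-- `ψ` is isotopic to the identity through `G`-equivariant diffeomorphisms: there is a
family `Ψ s`, `s ∈ [0, 1]`, of such diffeomorphisms, smooth on `[0, 1] × M`, from `id` to `ψ`
(the values of `Ψ` outside `[0, 1]` play no role). -/
def IsEquivariantlyIsotopicToId (ψ : M ≃ₘ^∞⟮𝓘(ℝ, E), 𝓘(ℝ, E)⟯ M) : Prop :=
  ∃ Ψ : ℝ → (M ≃ₘ^∞⟮𝓘(ℝ, E), 𝓘(ℝ, E)⟯ M),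
    ContMDiffOn (𝓘(ℝ, ℝ).prod 𝓘(ℝ, E)) 𝓘(ℝ, E) ∞ (fun q : ℝ × M => Ψ q.1 q.2)
      (Set.Icc (0 : ℝ) 1 ×ˢ Set.univ) ∧
    (∀ s ∈ Set.Icc (0 : ℝ) 1, IsEquivariant G (Ψ s)) ∧
    (∀ p, Ψ 0 p = p) ∧ (∀ p, Ψ 1 p = ψ p)

end Actions

/-! ### The double complex and homotopy moment maps -/

/-- The Chevalley–Eilenberg differential of a real Lie algebra (trivial coefficients in `V`):
`(d_𝔤 F)(x₁, …, x_{k+2}) = ∑_{i<j} (-1)^{i+j} F([x_i, x_j], x₁, …, x̂_i, …, x̂_j, …, x_{k+2})`.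
The parity of `i + j` is the same for indices that start at `0`. -/
def dCE {𝔤 V : Type*} [Bracket 𝔤 𝔤] [AddCommGroup V] [Module ℝ V] {k : ℕ}
    (F : (Fin (k + 1) → 𝔤) → V) (x : Fin (k + 2) → 𝔤) : V :=
  ∑ j : Fin (k + 2), ∑ i : Fin (k + 1),
    if i.castSucc < j then
      (-1 : ℝ) ^ ((i : ℕ) + (j : ℕ)) •
        F (Fin.cons ⁅x i.castSucc, x j⁆ fun l : Fin k => x (j.succAbove (i.succAbove l)))
    else 0

/-- The sign `ς(k) = -(-1)^{k(k+1)/2}`. -/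
def varsig (k : ℕ) : ℝ := -(-1) ^ (k * (k + 1) / 2)

section Cochains

variable (E : Type*) [NormedAddCommGroup E] [NormedSpace ℝ E]
  (M : Type*) [TopologicalSpace M] [ChartedSpace E M]
  (EG : Type*) [NormedAddCommGroup EG] [NormedSpace ℝ EG]
  (G : Type*) [TopologicalSpace G] [ChartedSpace EG G] [Group G]

/-- A family of elements `c k j` of `Λ^k 𝔤^* ⊗ Ω^j(M)`, that is, of alternating `k`-linear maps
from `𝔤` to `Ω^j(M)`. -/
abbrev BiCochain : Type _ :=
  ∀ k j : ℕ, GroupLieAlgebra 𝓘(ℝ, EG) G [⋀^Fin k]→ₗ[ℝ] Ω E M j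

variable {E M EG G}

/-- `c` is an element of `(Λ^{≥1} 𝔤^* ⊗ Ω(M))_m`, i.e. `c = c_1 + ⋯ + c_m` with `c_k` in
`Λ^k 𝔤^* ⊗ Ω^{m-k}(M)`. -/
def HasTotalDegree (m : ℕ) (c : BiCochain E M EG G) : Prop :=
  ∀ k j : ℕ, ¬(1 ≤ k ∧ k + j = m) → c k j = 0

/-- The total differential `d_tot = d_𝔤 + (-1)^k d` on `Λ^{≥1} 𝔤^* ⊗ Ω(M)`: the component of
`d_tot c` in `Λ^k 𝔤^* ⊗ Ω^j(M)`, evaluated on `k` elements of `𝔤`. -/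
def dTot (c : BiCochain E M EG G) :
    ∀ k j : ℕ, (Fin k → GroupLieAlgebra 𝓘(ℝ, EG) G) → FormField E M j
  | 0, _, _ => 0
  | 1, 0, _ => 0
  | 1, j + 1, x => -dForm (c 1 j x : FormField E M j)
  | k + 2, 0, x => dCE (fun y => (c (k + 1) 0 y : FormField E M 0)) x
  | k + 2, j + 1, x =>
      dCE (fun y => (c (k + 1) (j + 1) y : FormField E M (j + 1))) x +
        (-1 : ℝ) ^ (k + 2) • dForm (c (k + 2) j x : FormField E M j)

variable [MulAction G M]

/-- For a form `σ` of degree `N`, the element `σ̃ = ∑_{k=1}^N (-1)^{k-1} σ_k` where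
`σ_k (x₁, …, x_k) = ι(v_{x₁} ∧ ⋯ ∧ v_{x_k}) σ`: its component of bidegree `(k, j)`. -/
def tilde {N : ℕ} (σ : FormField E M N) (k j : ℕ)
    (x : Fin k → GroupLieAlgebra 𝓘(ℝ, EG) G) : FormField E M j :=
  if h : 1 ≤ k ∧ k + j = N then
    (-1 : ℝ) ^ (k - 1) • contract h.2 (fun a => infGen (x a)) σ
  else 0

/-- `f` is a homotopy moment map for the action of `G` on `(M, σ)`, where `σ` is an
`(n+1)`-form: a family of components `f_k : Λ^k 𝔤 → Ω^{n-k}(M)`, `1 ≤ k ≤ n`, such that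
* `d (f_1 x) = -ι(v_x) σ`;
* for `2 ≤ k ≤ n`, `∑_{i<j} (-1)^{i+j+1} f_{k-1}([x_i, x_j], …) =
  d (f_k (x₁, …, x_k)) + ς(k) ι(v_{x₁} ∧ ⋯ ∧ v_{x_k}) σ`;
* `∑_{i<j} (-1)^{i+j+1} f_n([x_i, x_j], …) = ς(n+1) ι(v_{x₁} ∧ ⋯ ∧ v_{x_{n+1}}) σ`.
Here `f_k` is `f k (n - k)`, and all the other `f k j` vanish. The last two conditions are
written with `k + 2` for `k`, resp. with `n = k + 1`. -/
structure IsMomentMap (n : ℕ) (σ : FormField E M (n + 1)) (f : BiCochain E M EG G) : Prop where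
  degree : HasTotalDegree n f
  first : ∀ (j : ℕ) (h : 1 + j = n) (x : GroupLieAlgebra 𝓘(ℝ, EG) G),
    dForm (f 1 j (fun _ => x) : FormField E M j) =
      -contract (k := 1) (m := j + 1) (by omega) (fun _ => infGen x) σ
  middle : ∀ (k j : ℕ) (h : k + 2 + j = n) (x : Fin (k + 2) → GroupLieAlgebra 𝓘(ℝ, EG) G),
    -dCE (fun y => (f (k + 1) (j + 1) y : FormField E M (j + 1))) x =
      dForm (f (k + 2) j x : FormField E M j) +
        varsig (k + 2) •
          contract (k := k + 2) (m := j + 1) (by omega) (fun a => infGen (x a)) σ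
  last : ∀ (k : ℕ) (h : k + 1 = n) (x : Fin (k + 2) → GroupLieAlgebra 𝓘(ℝ, EG) G),
    -dCE (fun y => (f (k + 1) 0 y : FormField E M 0)) x =
      varsig (k + 2) • contract (k := k + 2) (m := 0) (by omega) (fun a => infGen (x a)) σ

/-- The element `φ = φ_1 + ⋯ + φ_n`, `φ_k = ς(k) f_k`, that corresponds to `f`. -/
def toCochain (f : BiCochain E M EG G) : BiCochain E M EG G :=
  fun k j => varsig k • f k j

/-- Equivalence of the pairs `(σ, f)` and `(σ', f')`: there are
`η ∈ (Λ^{≥1} 𝔤^* ⊗ Ω(M))_{n-1}` and a `G`-invariant `α ∈ Ω^n(M)` with `σ' - σ = d α` and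
`φ' - φ = d_tot η + α̃`. -/
def MomentEquivalent {n : ℕ} (σ : FormField E M (n + 1)) (f : BiCochain E M EG G)
    (σ' : FormField E M (n + 1)) (f' : BiCochain E M EG G) : Prop :=
  ∃ (η : BiCochain E M EG G) (α : Ω E M n),
    HasTotalDegree (n - 1) η ∧ IsInvariantForm G (α : FormField E M n) ∧
    σ' - σ = dForm (α : FormField E M n) ∧
    ∀ (k j : ℕ) (x : Fin k → GroupLieAlgebra 𝓘(ℝ, EG) G),
      (toCochain f' k j x : FormField E M j) - (toCochain f k j x : FormField E M j) =
        dTot η k j x + tilde (α : FormField E M n) k j x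

/-- `f¹` and `f⁰` are intertwined by `ψ`: `ψ^* f¹_k = f⁰_k` for `k = 1, …, n`. -/
def IsIntertwined (n : ℕ) (ψ : M ≃ₘ^∞⟮𝓘(ℝ, E), 𝓘(ℝ, E)⟯ M) (f₁ f₀ : BiCochain E M EG G) : Prop :=
  ∀ (k j : ℕ), 1 ≤ k → k + j = n → ∀ x : Fin k → GroupLieAlgebra 𝓘(ℝ, EG) G,
    pullback ψ (f₁ k j x : FormField E M j) = (f₀ k j x : FormField E M j)

end Cochains

end HomotopyMoment

end

/-!
Let `H : ℝ × M → M` be a smooth homotopy from the identity to `ψ` through equivariant maps; it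
exists because an isotopy parametrized by `[0, 1]` can be reparametrized by a smooth step function.
The homotopy operator of de Rham theory

  `h σ = ∫₀¹ ι(∂/∂s) H^* σ ds`

lowers the degree of forms by one and satisfies `d h + h d = H_1^* - H_0^*`
(`dForm_homotopyOp_add_homotopyOp_dForm`). Since the maps `H_s` are equivariant, they preserve the
infinitesimal generators of the action, so that `h` commutes with contractions by them up to sign,
`h ι(v₁ ∧ ⋯ ∧ v_k) = (-1)^k ι(v₁ ∧ ⋯ ∧ v_k) h` (`homotopyOp_contract`), and `h` preserves invariant
forms (`isInvariantForm_homotopyOp`). Being linear, it commutes with `d_𝔤` as well.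

The equations of a homotopy moment map say that
`d φ_k = -ω_k + (-1)^{k-1} d_𝔤 φ_{k-1}`, where `ω_k = ι(v₁ ∧ ⋯ ∧ v_k) ω` and `φ_0 = 0`
(`dForm_toCochain_one`, `dForm_toCochain_add_two`). With `α = -h ω¹` and `η_k = (-1)^{k+1} h φ¹_k`,
the homotopy formula for `ω¹` reads `ω¹ - ω⁰ = d α`, and the homotopy formula for `φ¹_k` reads

  `φ¹_k - φ⁰_k = -d h φ¹_k - h d φ¹_k = (-1)^k d η_k + d_𝔤 η_{k-1} + (-1)^{k-1} α_k`,

which is the claim (`momentEquivalent_of_homotopy`).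

The homotopy formula is proved in the charts of the source of `H`. There `H^* σ` is a form `τ` on an
open subset of `ℝ × E`, smooth and with exterior derivative `H^* dσ` (`contDiffOn_vectorPullback`,
`extDeriv_vectorPullback`). Cartan's formula on `ℝ × E` (`contractLine_extDeriv_succ`) is integrated
over `s`, and the exterior derivative is exchanged with the integral
(`hasFDerivAt_integral_slice`).
-/

/-! ### Alternating forms on a finite-dimensional space -/

namespace ContinuousAlternatingMap

variable {E : Type*} [NormedAddCommGroup E] [NormedSpace ℝ E] [FiniteDimensional ℝ E]
  {F : Type*} [NormedAddCommGroup F] [NormedSpace ℝ F]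

variable (E) in
/-- The values of an alternating form on all tuples of vectors of a basis. -/
noncomputable def evalBasis (k : ℕ) :
    (E [⋀^Fin k]→L[ℝ] ℝ) →ₗ[ℝ] (Fin k → Fin (Module.finrank ℝ E)) → ℝ :=
  LinearMap.pi fun r => (apply ℝ E ℝ fun i => Module.finBasis ℝ E (r i)).toLinearMap

theorem evalBasis_injective (k : ℕ) : Function.Injective (evalBasis E k) := by
  intro f g h
  apply toAlternatingMap_injective
  refine Module.Basis.ext_alternating (Module.finBasis ℝ E) fun r _ => ?_
  exact congrFun h r

instance finiteDimensional_real (k : ℕ) : FiniteDimensional ℝ (E [⋀^Fin k]→L[ℝ] ℝ) :=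
  FiniteDimensional.of_injective (evalBasis E k) (evalBasis_injective k)

/-- A family of alternating forms on a finite-dimensional space is smooth if its values on all
fixed tuples of vectors are: the form is recovered linearly from finitely many values. -/
theorem contDiffWithinAt_of_apply {k : ℕ} {n : ℕ∞ω} {s : Set F} {x : F}
    {f : F → E [⋀^Fin k]→L[ℝ] ℝ}
    (h : ∀ v, ContDiffWithinAt ℝ n (fun x => f x v) s x) : ContDiffWithinAt ℝ n f s x := by
  obtain ⟨g, hg⟩ := (evalBasis E k).exists_leftInverse_of_injective
    (LinearMap.ker_eq_bot.2 (evalBasis_injective k))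
  have : f = fun x => g.toContinuousLinearMap (evalBasis E k (f x)) := by
    funext x
    exact (LinearMap.congr_fun hg (f x)).symm
  rw [this]
  refine g.toContinuousLinearMap.contDiff.comp_contDiffWithinAt (contDiffWithinAt_pi.2 fun r => ?_)
  exact h _

end ContinuousAlternatingMap

theorem ContDiffWithinAt.continuousAlternatingMap_compContinuousLinearMap
    {E : Type*} [NormedAddCommGroup E] [NormedSpace ℝ E]
    {E' : Type*} [NormedAddCommGroup E'] [NormedSpace ℝ E'] [FiniteDimensional ℝ E']
    {F : Type*} [NormedAddCommGroup F] [NormedSpace ℝ F] {k : ℕ} {n : ℕ∞ω} {s : Set F}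
    {x : F} {f : F → E [⋀^Fin k]→L[ℝ] ℝ} {A : F → E' →L[ℝ] E}
    (hf : ContDiffWithinAt ℝ n f s x) (hA : ContDiffWithinAt ℝ n A s x) :
    ContDiffWithinAt ℝ n (fun x => (f x).compContinuousLinearMap (A x)) s x := by
  refine ContinuousAlternatingMap.contDiffWithinAt_of_apply fun v => ?_
  have h1 : ContDiffWithinAt ℝ n (fun x =>
      ContinuousMultilinearMap.compContinuousLinearMapContinuousMultilinear ℝ
        (fun _ : Fin k => E') (fun _ => E) ℝ (fun _ => A x)) s x :=
    (ContinuousMultilinearMap.contDiff _).comp_contDiffWithinAt (contDiffWithinAt_pi.2 fun _ => hA)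
  have h2 : ContDiffWithinAt ℝ n (fun x => (f x).toContinuousMultilinearMap) s x :=
    (ContinuousAlternatingMap.toContinuousMultilinearMapCLM (𝕜 := ℝ) (E := E) (F := ℝ)
      (ι := Fin k) ℝ).contDiff.comp_contDiffWithinAt hf
  exact (ContinuousMultilinearMap.apply ℝ (fun _ : Fin k => E') ℝ v).contDiff.comp_contDiffWithinAt
    (h1.clm_apply h2)

/-! ### Integrals depending smoothly on a parameter -/

section ParametricIntegral

universe u

open intervalIntegral MeasureTheory Set

theorem continuous_slice_of_continuousOn {E F : Type*} [TopologicalSpace E] [TopologicalSpace F]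
    {V : Set E}
    {g : ℝ × E → F} (hg : ContinuousOn g (univ ×ˢ V)) {y : E} (hy : y ∈ V) :
    Continuous fun s => g (s, y) :=
  hg.comp_continuous (by fun_prop) fun s => ⟨mem_univ s, hy⟩

variable {E F : Type u} [NormedAddCommGroup E] [NormedSpace ℝ E]
  [NormedAddCommGroup F] [NormedSpace ℝ F]

theorem hasFDerivAt_slice {V : Set E} (hV : IsOpen V) {g : ℝ × E → F}
    (hg : ContDiffOn ℝ ∞ g (univ ×ˢ V)) (s : ℝ) {y : E} (hy : y ∈ V) :
    HasFDerivAt (fun y => g (s, y))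
      ((fderiv ℝ g (s, y)).comp (ContinuousLinearMap.inr ℝ ℝ E)) y := by
  have h1 : DifferentiableAt ℝ g (s, y) :=
    (hg.contDiffAt ((isOpen_univ.prod hV).mem_nhds ⟨mem_univ s, hy⟩)).differentiableAt (by simp)
  exact h1.hasFDerivAt.comp y (hasFDerivAt_prodMk_right s y)

theorem contDiffOn_fderiv_slice {V : Set E} (hV : IsOpen V) {g : ℝ × E → F}
    (hg : ContDiffOn ℝ ∞ g (univ ×ˢ V)) :
    ContDiffOn ℝ ∞ (fun q => (fderiv ℝ g q).comp (ContinuousLinearMap.inr ℝ ℝ E))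
      (univ ×ˢ V) :=
  (hg.fderiv_of_isOpen (isOpen_univ.prod hV) (by simp)).clm_comp contDiffOn_const

variable [FiniteDimensional ℝ E]

theorem hasFDerivAt_integral_slice {V : Set E} (hV : IsOpen V) {g : ℝ × E → F}
    (hg : ContDiffOn ℝ ∞ g (univ ×ˢ V)) {y : E} (hy : y ∈ V) :
    HasFDerivAt (fun y => ∫ s in (0 : ℝ)..1, g (s, y))
      (∫ s in (0 : ℝ)..1, (fderiv ℝ g (s, y)).comp (ContinuousLinearMap.inr ℝ ℝ E)) y := by
  have hg' := (contDiffOn_fderiv_slice hV hg).continuousOn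
  -- The derivative is bounded on a compact neighbourhood of `[0, 1] × {y}`.
  obtain ⟨r, hr, hrV⟩ := Metric.nhds_basis_closedBall.mem_iff.1 (hV.mem_nhds hy)
  obtain ⟨C, hC⟩ := (isCompact_Icc (a := (0 : ℝ)) (b := 1)).prod
    (isCompact_closedBall y r) |>.exists_bound_of_continuousOn
      (hg'.mono (prod_mono (subset_univ _) hrV))
  refine hasFDerivAt_integral_of_dominated_of_fderiv_le (F := fun y s => g (s, y))
    (F' := fun y s => (fderiv ℝ g (s, y)).comp (ContinuousLinearMap.inr ℝ ℝ E))
    (bound := fun _ => C) (Metric.closedBall_mem_nhds y hr) ?_ ?_ ?_ ?_ (by simp) ?_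
  · filter_upwards [hV.mem_nhds hy] with z hz
    exact (continuous_slice_of_continuousOn hg.continuousOn hz).aestronglyMeasurable
  · exact (continuous_slice_of_continuousOn hg.continuousOn hy).intervalIntegrable _ _
  · exact (continuous_slice_of_continuousOn hg' hy).aestronglyMeasurable
  · refine Filter.Eventually.of_forall fun s hs z hz => hC (s, z) ⟨?_, hz⟩
    rw [uIoc_of_le zero_le_one] at hs
    exact Ioc_subset_Icc_self hs
  · exact Filter.Eventually.of_forall fun s _ z hz => hasFDerivAt_slice hV hg s (hrV hz)

theorem contDiffOn_integral_slice {V : Set E} (hV : IsOpen V) {g : ℝ × E → F}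
    (hg : ContDiffOn ℝ ∞ g (univ ×ˢ V)) :
    ContDiffOn ℝ ∞ (fun y => ∫ s in (0 : ℝ)..1, g (s, y)) V := by
  refine contDiffOn_infty.2 fun n => ?_
  -- The derivative is an integral of the same kind, with values in `E →L[ℝ] F`; the induction over
  -- all `F` in one universe needs `E` to lie in it too.
  induction n generalizing F with
  | zero =>
    exact contDiffOn_zero.2 fun y hy =>
      (hasFDerivAt_integral_slice hV hg hy).continuousAt.continuousWithinAt
  | succ n ih =>
    have := (contDiffOn_succ_iff_fderiv_of_isOpen (𝕜 := ℝ) (n := n)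
      (f := fun y => ∫ s in (0 : ℝ)..1, g (s, y)) hV).2 ⟨fun y hy =>
        (hasFDerivAt_integral_slice hV hg hy).differentiableAt.differentiableWithinAt, by simp,
        (ih (contDiffOn_fderiv_slice hV hg)).congr fun y hy =>
          (hasFDerivAt_integral_slice hV hg hy).fderiv⟩
    simpa using this

end ParametricIntegral

namespace HomotopyMoment

/-! ### The homotopy formula on a product of the line with an open set -/

section Local

universe u

open ContinuousAlternatingMap Set

variable {E : Type u} [NormedAddCommGroup E] [NormedSpace ℝ E]

/-- The contraction of a form on `ℝ × E` by the unit vector of `ℝ`, restricted to `E`. -/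
noncomputable def contractLine (E : Type*) [NormedAddCommGroup E] [NormedSpace ℝ E] (k : ℕ) :
    ((ℝ × E) [⋀^Fin (k + 1)]→L[ℝ] ℝ) →L[ℝ] E [⋀^Fin k]→L[ℝ] ℝ :=
  (compContinuousLinearMapCLM (ContinuousLinearMap.inr ℝ ℝ E)).comp
    ((ContinuousLinearMap.apply ℝ _ ((1, 0) : ℝ × E)).comp
      curryLeftLI.toContinuousLinearMap)

/-- The restriction to `E` of a form on `ℝ × E`. -/
noncomputable def restrictSlice (E : Type*) [NormedAddCommGroup E] [NormedSpace ℝ E] (k : ℕ) :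
    ((ℝ × E) [⋀^Fin k]→L[ℝ] ℝ) →L[ℝ] E [⋀^Fin k]→L[ℝ] ℝ :=
  compContinuousLinearMapCLM (ContinuousLinearMap.inr ℝ ℝ E)

theorem contractLine_apply {k : ℕ} (f : (ℝ × E) [⋀^Fin (k + 1)]→L[ℝ] ℝ) (w : Fin k → E) :
    contractLine E k f w = f (Matrix.vecCons (1, 0) fun i => (0, w i)) := rfl

theorem restrictSlice_apply {k : ℕ} (f : (ℝ × E) [⋀^Fin k]→L[ℝ] ℝ) (w : Fin k → E) :
    restrictSlice E k f w = f fun i => (0, w i) := rfl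

theorem hasDerivAt_restrictSlice {k : ℕ} {τ : ℝ × E → (ℝ × E) [⋀^Fin k]→L[ℝ] ℝ} {s : ℝ} {y : E}
    (hτ : DifferentiableAt ℝ τ (s, y)) :
    HasDerivAt (fun s => restrictSlice E k (τ (s, y)))
      (restrictSlice E k (fderiv ℝ τ (s, y) (1, 0))) s := by
  have h1 : HasDerivAt (fun s : ℝ => (s, y)) ((1 : ℝ), (0 : E)) s :=
    (hasDerivAt_id s).prodMk (hasDerivAt_const s y)
  exact (restrictSlice E k).hasFDerivAt.comp_hasDerivAt s
    (hτ.hasFDerivAt.comp_hasDerivAt s h1)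

/-- Cartan's formula for functions, where the term `d ι` is absent. -/
theorem contractLine_extDeriv_zero {τ : ℝ × E → (ℝ × E) [⋀^Fin 0]→L[ℝ] ℝ} {q : ℝ × E} :
    contractLine E 0 (extDeriv τ q) = restrictSlice E 0 (fderiv ℝ τ q (1, 0)) := by
  ext w
  rw [contractLine_apply, restrictSlice_apply, extDeriv, alternatizeUncurryFin_apply]
  simp

/-- Cartan's formula `L_{∂/∂s} = ι d + d ι` on `ℝ × E`, restricted to the slices. -/
theorem contractLine_extDeriv_succ {k : ℕ} {τ : ℝ × E → (ℝ × E) [⋀^Fin (k + 1)]→L[ℝ] ℝ} {s : ℝ}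
    {y : E} (hτ : DifferentiableAt ℝ τ (s, y)) :
    contractLine E (k + 1) (extDeriv τ (s, y)) +
        extDeriv (fun y => contractLine E k (τ (s, y))) y =
      restrictSlice E (k + 1) (fderiv ℝ τ (s, y) (1, 0)) := by
  have h1 : HasFDerivAt (fun y => contractLine E k (τ (s, y)))
      ((contractLine E k).comp ((fderiv ℝ τ (s, y)).comp (ContinuousLinearMap.inr ℝ ℝ E))) y :=
    (contractLine E k).hasFDerivAt.comp y
      (hτ.hasFDerivAt.comp y (hasFDerivAt_prodMk_right s y))
  ext w
  rw [ContinuousAlternatingMap.add_apply, contractLine_apply, restrictSlice_apply, extDeriv,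
    extDeriv, h1.fderiv, alternatizeUncurryFin_apply, alternatizeUncurryFin_apply,
    Fin.sum_univ_succ, add_assoc, ← Finset.sum_add_distrib]
  rw [Finset.sum_eq_zero, add_zero]
  · simp
  · intro i _
    have : (i.succ.removeNth (Matrix.vecCons ((1 : ℝ), (0 : E)) fun i => (0, w i)) :
        Fin (k + 1) → ℝ × E) = Matrix.vecCons (1, 0) fun j => (0, i.removeNth w j) := by
      funext j
      refine Fin.cases ?_ (fun j => ?_) j
      · simp [Fin.removeNth]
      · simp [Fin.removeNth]
    rw [this]
    simp [contractLine_apply, pow_succ]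

end Local

open Set Filter Topology ContinuousAlternatingMap

/-! ### Derivatives and forms in terms of the model space -/

section Model

variable {E : Type*} [NormedAddCommGroup E] [NormedSpace ℝ E]
  {M : Type*} [TopologicalSpace M] [ChartedSpace E M]
  {E' : Type*} [NormedAddCommGroup E'] [NormedSpace ℝ E']
  {M' : Type*} [TopologicalSpace M'] [ChartedSpace E' M']
  {E'' : Type*} [NormedAddCommGroup E''] [NormedSpace ℝ E'']
  {M'' : Type*} [TopologicalSpace M''] [ChartedSpace E'' M'']

/-- The derivative of a map between manifolds as a linear map between the model spaces. The tangent
spaces are the model spaces by definition; forgetting the base points makes it possible to rewrite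
them, and gives the values of forms a norm. -/
noncomputable def modelDeriv (f : M → M') (p : M) : E →L[ℝ] E' :=
  mfderiv 𝓘(ℝ, E) 𝓘(ℝ, E') f p

/-- The value of a form at a point as an alternating form on the model space. -/
def formAt {k : ℕ} (σ : FormField E M k) (p : M) : E [⋀^Fin k]→L[ℝ] ℝ := σ p

/-- The value of a vector field at a point as an element of the model space. -/
def vectorAt (v : VField E M) (p : M) : E := v p

theorem modelDeriv_comp {g : M' → M''} {f : M → M'} {p : M}
    (hg : MDifferentiableAt 𝓘(ℝ, E') 𝓘(ℝ, E'') g (f p))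
    (hf : MDifferentiableAt 𝓘(ℝ, E) 𝓘(ℝ, E') f p) :
    modelDeriv (E := E) (E' := E'') (fun x => g (f x)) p =
      (modelDeriv (E := E') (E' := E'') g (f p)).comp (modelDeriv (E := E) (E' := E') f p) :=
  mfderiv_comp p hg hf

theorem modelDeriv_congr {f g : M → M'} {p : M} (h : f =ᶠ[𝓝 p] g) :
    modelDeriv (E := E) (E' := E') f p = modelDeriv (E := E) (E' := E') g p :=
  h.mfderiv_eq

theorem modelDeriv_id (p : M) :
    modelDeriv (E := E) (E' := E) (fun x : M => x) p = ContinuousLinearMap.id ℝ E :=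
  mfderiv_id

theorem modelDeriv_eq_fderiv (f : E → E') (x : E) :
    modelDeriv (E := E) (E' := E') f x = fderiv ℝ f x :=
  mfderiv_eq_fderiv

theorem formAt_pullback {k : ℕ} (f : M → M') (σ : FormField E' M' k) (p : M) :
    formAt (pullback (E := E) f σ) p =
      (formAt σ (f p)).compContinuousLinearMap (modelDeriv (E := E) (E' := E') f p) := rfl

theorem formField_ext {k : ℕ} {σ σ' : FormField E M k} (h : ∀ p, formAt σ p = formAt σ' p) :
    σ = σ' := funext h

theorem inChart_apply {k : ℕ} (σ : FormField E M k) (p₀ : M) (y : E) :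
    inChart p₀ σ y = (formAt σ ((extChartAt 𝓘(ℝ, E) p₀).symm y)).compContinuousLinearMap
      (modelDeriv (E := E) (E' := E) (extChartAt 𝓘(ℝ, E) p₀).symm y) := rfl

theorem formAt_dForm {k : ℕ} (σ : FormField E M k) (p : M) :
    formAt (dForm σ) p = (extDeriv (inChart p σ) (extChartAt 𝓘(ℝ, E) p p)).compContinuousLinearMap
      (modelDeriv (E := E) (E' := E) (extChartAt 𝓘(ℝ, E) p) p) := rfl

/-- The pullback of a form to a vector space. -/
noncomputable def vectorPullback {k : ℕ} (K : E' → M) (σ : FormField E M k) :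
    E' → E' [⋀^Fin k]→L[ℝ] ℝ :=
  fun q => (formAt σ (K q)).compContinuousLinearMap (modelDeriv (E := E') (E' := E) K q)

theorem contDiffAt_inChart {k : ℕ} {σ : FormField E M k} (hσ : IsSmoothForm σ) (p : M) :
    ContDiffAt ℝ ∞ (inChart p σ) (extChartAt 𝓘(ℝ, E) p p) :=
  (hσ p).contDiffAt ((isOpen_extChartAt_target p).mem_nhds (mem_extChartAt_target p))

variable [IsManifold 𝓘(ℝ, E) ∞ M]

theorem mdifferentiableAt_chart_symm (p₀ : M) {y : E} (hy : y ∈ (extChartAt 𝓘(ℝ, E) p₀).target) :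
    MDifferentiableAt 𝓘(ℝ, E) 𝓘(ℝ, E) (extChartAt 𝓘(ℝ, E) p₀).symm y :=
  ((contMDiffOn_extChartAt_symm (n := ∞) p₀).contMDiffAt
    ((isOpen_extChartAt_target p₀).mem_nhds hy)).mdifferentiableAt (by simp)

theorem mdifferentiableAt_chart {p₀ p : M} (hp : p ∈ (extChartAt 𝓘(ℝ, E) p₀).source) :
    MDifferentiableAt 𝓘(ℝ, E) 𝓘(ℝ, E) (extChartAt 𝓘(ℝ, E) p₀) p :=
  haveI : IsManifold 𝓘(ℝ, E) 1 M := .of_le (n := ∞) (by simp)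
  mdifferentiableAt_extChartAt (by simpa using hp)

theorem modelDeriv_chart_symm_comp_modelDeriv_chart (p : M) :
    (modelDeriv (E := E) (E' := E) (extChartAt 𝓘(ℝ, E) p).symm (extChartAt 𝓘(ℝ, E) p p)).comp
      (modelDeriv (E := E) (E' := E) (extChartAt 𝓘(ℝ, E) p) p) = ContinuousLinearMap.id ℝ E := by
  rw [← modelDeriv_comp (E := E) (E' := E) (E'' := E) (M' := E)
    (g := (extChartAt 𝓘(ℝ, E) p).symm) (f := extChartAt 𝓘(ℝ, E) p)
    (mdifferentiableAt_chart_symm p (mem_extChartAt_target (I := 𝓘(ℝ, E)) p))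
    (mdifferentiableAt_chart (mem_extChartAt_source (I := 𝓘(ℝ, E)) p)), ← modelDeriv_id (E := E) p]
  apply modelDeriv_congr
  filter_upwards [extChartAt_source_mem_nhds (I := 𝓘(ℝ, E)) p] with q hq
  exact (extChartAt 𝓘(ℝ, E) p).left_inv hq

/-- A form is recovered at the centre of a chart from its expression in the chart. -/
theorem inChart_compContinuousLinearMap {k : ℕ} (σ : FormField E M k) (p : M) :
    (inChart p σ (extChartAt 𝓘(ℝ, E) p p)).compContinuousLinearMap
      (modelDeriv (E := E) (E' := E) (extChartAt 𝓘(ℝ, E) p) p) = formAt σ p := by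
  have h : formAt σ ((extChartAt 𝓘(ℝ, E) p).symm (extChartAt 𝓘(ℝ, E) p p)) = formAt σ p := by
    rw [extChartAt_to_inv]
  rw [inChart_apply, h]
  ext v
  have := fun w => DFunLike.congr_fun
    (modelDeriv_chart_symm_comp_modelDeriv_chart (E := E) p) w
  simp only [ContinuousLinearMap.comp_apply, ContinuousLinearMap.id_apply] at this
  simp only [compContinuousLinearMap_apply, Function.comp_def, this]

end Model

/-! ### Pulling back to a vector space -/

section Pullback

variable {E : Type*} [NormedAddCommGroup E] [NormedSpace ℝ E]
  {M : Type*} [TopologicalSpace M] [ChartedSpace E M]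
  {F : Type*} [NormedAddCommGroup F] [NormedSpace ℝ F]
  {k : ℕ} {U : Set F} {K : F → M} {σ : FormField E M k}

theorem contDiffAt_chart_comp (hU : IsOpen U)
    (hK : ContMDiffOn 𝓘(ℝ, F) 𝓘(ℝ, E) ∞ K U) {q₀ : F} (hq₀ : q₀ ∈ U) :
    ContDiffAt ℝ ∞ (fun q => extChartAt 𝓘(ℝ, E) (K q₀) (K q)) q₀ :=
  ContMDiffAt.contDiffAt <|
    (contMDiffAt_extChartAt (n := ∞)).comp q₀ (hK.contMDiffAt (hU.mem_nhds hq₀))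

variable [IsManifold 𝓘(ℝ, E) ∞ M]

/-- A pullback to a vector space is locally the pullback of an expression in a chart. -/
theorem vectorPullback_eventuallyEq (hU : IsOpen U)
    (hK : ContMDiffOn 𝓘(ℝ, F) 𝓘(ℝ, E) ∞ K U) (σ : FormField E M k) {q₀ : F} (hq₀ : q₀ ∈ U) :
    vectorPullback K σ =ᶠ[𝓝 q₀] fun q =>
      (inChart (K q₀) σ (extChartAt 𝓘(ℝ, E) (K q₀) (K q))).compContinuousLinearMap
        (fderiv ℝ (fun q => extChartAt 𝓘(ℝ, E) (K q₀) (K q)) q) := by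
  have hs : ∀ᶠ q in 𝓝 q₀, K q ∈ (extChartAt 𝓘(ℝ, E) (K q₀)).source :=
    (hK.continuousOn.continuousAt (hU.mem_nhds hq₀)).eventually
      (extChartAt_source_mem_nhds (I := 𝓘(ℝ, E)) (K q₀))
  filter_upwards [hs.eventually_nhds, hU.mem_nhds hq₀] with q hq hqU
  have hKq : MDifferentiableAt 𝓘(ℝ, F) 𝓘(ℝ, E) K q :=
    (hK.contMDiffAt (hU.mem_nhds hqU)).mdifferentiableAt (by simp)
  have hq' := hq.self_of_nhds
  have hD : modelDeriv (E := F) (E' := E) K q =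
      (modelDeriv (E := E) (E' := E) (extChartAt 𝓘(ℝ, E) (K q₀)).symm
        (extChartAt 𝓘(ℝ, E) (K q₀) (K q))).comp
        (fderiv ℝ (fun q => extChartAt 𝓘(ℝ, E) (K q₀) (K q)) q) := by
    rw [← modelDeriv_eq_fderiv, ← modelDeriv_comp (E := F) (E' := E) (E'' := E)
      (g := (extChartAt 𝓘(ℝ, E) (K q₀)).symm) (f := fun q => extChartAt 𝓘(ℝ, E) (K q₀) (K q))
      (mdifferentiableAt_chart_symm (K q₀) ((extChartAt 𝓘(ℝ, E) (K q₀)).map_source hq'))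
      ((mdifferentiableAt_chart hq').comp q hKq)]
    apply modelDeriv_congr
    filter_upwards [hq] with r hr
    exact ((extChartAt 𝓘(ℝ, E) (K q₀)).left_inv hr).symm
  rw [vectorPullback, inChart_apply, hD, (extChartAt 𝓘(ℝ, E) (K q₀)).left_inv hq']
  rfl

theorem contDiffOn_vectorPullback [FiniteDimensional ℝ F] (hU : IsOpen U)
    (hK : ContMDiffOn 𝓘(ℝ, F) 𝓘(ℝ, E) ∞ K U) (hσ : IsSmoothForm σ) :
    ContDiffOn ℝ ∞ (vectorPullback K σ) U := by
  intro q₀ hq₀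
  have hκ := contDiffAt_chart_comp hU hK hq₀
  refine ContDiffAt.contDiffWithinAt (ContDiffAt.congr_of_eventuallyEq ?_
    (vectorPullback_eventuallyEq hU hK σ hq₀))
  have h1 : ContDiffAt ℝ ∞
      (fun q => inChart (K q₀) σ (extChartAt 𝓘(ℝ, E) (K q₀) (K q))) q₀ :=
    ContDiffAt.comp (g := inChart (K q₀) σ) q₀ (contDiffAt_inChart hσ (K q₀)) hκ
  have h2 : ContDiffAt ℝ ∞
      (fderiv ℝ (fun q => extChartAt 𝓘(ℝ, E) (K q₀) (K q))) q₀ := hκ.fderiv_right (by simp)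
  rw [← contDiffWithinAt_univ] at h1 h2 ⊢
  exact h1.continuousAlternatingMap_compContinuousLinearMap h2

/-- The exterior derivative commutes with pullbacks to a vector space. At a point `q` the chart used
by `dForm` is the one around `K q`, so that no change of charts is involved. -/
theorem extDeriv_vectorPullback (hU : IsOpen U)
    (hK : ContMDiffOn 𝓘(ℝ, F) 𝓘(ℝ, E) ∞ K U) (hσ : IsSmoothForm σ) {q : F} (hq : q ∈ U) :
    extDeriv (vectorPullback K σ) q = vectorPullback K (dForm σ) q := by
  have hd : DifferentiableAt ℝ (inChart (K q) σ)
      ((fun r => extChartAt 𝓘(ℝ, E) (K q) (K r)) q) :=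
    (contDiffAt_inChart hσ (K q)).differentiableAt (by simp)
  rw [(vectorPullback_eventuallyEq hU hK σ hq).extDeriv_eq,
    extDeriv_pullback (r := ∞) (f := fun r => extChartAt 𝓘(ℝ, E) (K q) (K r)) hd
      (contDiffAt_chart_comp hU hK hq)
      (by simpa using WithTop.coe_le_coe.2 (le_top : (2 : ℕ∞) ≤ ⊤))]
  have hKq : MDifferentiableAt 𝓘(ℝ, F) 𝓘(ℝ, E) K q :=
    (hK.contMDiffAt (hU.mem_nhds hq)).mdifferentiableAt (by simp)
  rw [← modelDeriv_eq_fderiv, modelDeriv_comp (g := extChartAt 𝓘(ℝ, E) (K q)) (f := K)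
    (mdifferentiableAt_chart (mem_extChartAt_source (I := 𝓘(ℝ, E)) (K q))) hKq]
  rfl

end Pullback
/-! ### The homotopy operator -/

section Homotopy

universe u

variable {E : Type u} [NormedAddCommGroup E] [NormedSpace ℝ E]
  {M : Type*} [TopologicalSpace M] [ChartedSpace E M]

/-- The form `H_s^* (ι(∂H/∂s) σ)`, that is, the contraction of the pullback of `σ` under
`H : ℝ × M → M` by `∂/∂s`, restricted to the slice `{s} × M`. -/
noncomputable def homotopyIntegrand {k : ℕ} (H : ℝ → M → M) (σ : FormField E M (k + 1)) (s : ℝ)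
    (p : M) : E [⋀^Fin k]→L[ℝ] ℝ :=
  ((formAt σ (H s p)).curryLeft
    (modelDeriv (E := ℝ) (E' := E) (fun s => H s p) s 1)).compContinuousLinearMap
      (modelDeriv (E := E) (E' := E) (H s) p)

/-- The homotopy operator of de Rham theory: the integral of `homotopyIntegrand` over `[0, 1]`. -/
noncomputable def homotopyOp {k : ℕ} (H : ℝ → M → M) (σ : FormField E M (k + 1)) :
    FormField E M k :=
  fun p => (∫ s in (0 : ℝ)..1, homotopyIntegrand H σ s p : E [⋀^Fin k]→L[ℝ] ℝ)

theorem formAt_homotopyOp {k : ℕ} (H : ℝ → M → M) (σ : FormField E M (k + 1)) (p : M) :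
    formAt (homotopyOp H σ) p = ∫ s in (0 : ℝ)..1, homotopyIntegrand H σ s p := rfl

/-- The homotopy `H` in the chart around `p₀` of its source. -/
noncomputable def chartHomotopy (H : ℝ → M → M) (p₀ : M) : ℝ × E → M :=
  fun q => H q.1 ((extChartAt 𝓘(ℝ, E) p₀).symm q.2)

variable {k : ℕ} {H : ℝ → M → M}
  (hH : ContMDiff (𝓘(ℝ, ℝ).prod 𝓘(ℝ, E)) 𝓘(ℝ, E) ∞ (fun q : ℝ × M => H q.1 q.2))

include hH

theorem mdifferentiableAt_slice (s : ℝ) (p : M) :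
    MDifferentiableAt 𝓘(ℝ, E) 𝓘(ℝ, E) (H s) p := by
  have : ContMDiff 𝓘(ℝ, E) 𝓘(ℝ, E) ∞ (fun p => H s p) :=
    hH.comp (f := fun p : M => (s, p)) (contMDiff_const.prodMk contMDiff_id)
  exact this.mdifferentiableAt (by simp)

theorem mdifferentiableAt_path (s : ℝ) (p : M) :
    MDifferentiableAt 𝓘(ℝ, ℝ) 𝓘(ℝ, E) (fun s => H s p) s := by
  have : ContMDiff 𝓘(ℝ, ℝ) 𝓘(ℝ, E) ∞ (fun s => H s p) :=
    hH.comp (f := fun s : ℝ => (s, p)) (contMDiff_id.prodMk contMDiff_const)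
  exact this.mdifferentiableAt (by simp)

variable [IsManifold 𝓘(ℝ, E) ∞ M]

theorem contMDiffOn_chartHomotopy (p₀ : M) :
    ContMDiffOn 𝓘(ℝ, ℝ × E) 𝓘(ℝ, E) ∞ (chartHomotopy (E := E) H p₀)
      (univ ×ˢ (extChartAt 𝓘(ℝ, E) p₀).target) := by
  refine hH.comp_contMDiffOn (g := fun q : ℝ × M => H q.1 q.2)
    (f := fun q : ℝ × E => (q.1, (extChartAt 𝓘(ℝ, E) p₀).symm q.2)) (ContMDiffOn.prodMk ?_ ?_)
  · exact contDiff_fst.contMDiff.contMDiffOn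
  · exact (contMDiffOn_extChartAt_symm p₀).comp
      (contDiff_snd (𝕜 := ℝ) (E := ℝ) (F := E)).contMDiff.contMDiffOn fun q hq => hq.2

theorem modelDeriv_chartHomotopy (p₀ : M) (s : ℝ) {y : E}
    (hy : y ∈ (extChartAt 𝓘(ℝ, E) p₀).target) (t : ℝ) (w : E) :
    modelDeriv (E := ℝ × E) (E' := E) (chartHomotopy H p₀) (s, y) (t, w) =
      modelDeriv (E := ℝ) (E' := E) (fun s => H s ((extChartAt 𝓘(ℝ, E) p₀).symm y)) s t +
      modelDeriv (E := E) (E' := E) (H s) ((extChartAt 𝓘(ℝ, E) p₀).symm y)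
        (modelDeriv (E := E) (E' := E) (extChartAt 𝓘(ℝ, E) p₀).symm y w) := by
  have hK : MDifferentiableAt 𝓘(ℝ, ℝ × E) 𝓘(ℝ, E) (chartHomotopy (E := E) H p₀) (s, y) :=
    ((contMDiffOn_chartHomotopy hH p₀).contMDiffAt
      ((isOpen_univ.prod (isOpen_extChartAt_target p₀)).mem_nhds
        ⟨mem_univ s, hy⟩)).mdifferentiableAt (by simp)
  have h1 : HasFDerivAt (fun s : ℝ => (s, y)) (ContinuousLinearMap.inl ℝ ℝ E) s :=
    hasFDerivAt_prodMk_left s y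
  have h2 : HasFDerivAt (fun y : E => (s, y)) (ContinuousLinearMap.inr ℝ ℝ E) y :=
    hasFDerivAt_prodMk_right s y
  have e1 := modelDeriv_comp (E := ℝ) (E' := ℝ × E) (E'' := E) (p := s)
    (g := chartHomotopy (E := E) H p₀) (f := fun s : ℝ => (s, y)) hK
    h1.differentiableAt.mdifferentiableAt
  have e2 := modelDeriv_comp (E := E) (E' := ℝ × E) (E'' := E) (p := y)
    (g := chartHomotopy (E := E) H p₀) (f := fun y : E => (s, y)) hK
    h2.differentiableAt.mdifferentiableAt
  rw [modelDeriv_eq_fderiv, h1.fderiv] at e1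
  rw [modelDeriv_eq_fderiv, h2.fderiv] at e2
  have e3 := modelDeriv_comp (E := E) (E' := E) (E'' := E) (p := y) (g := H s)
    (f := (extChartAt 𝓘(ℝ, E) p₀).symm) (mdifferentiableAt_slice hH s _)
    (mdifferentiableAt_chart_symm p₀ hy)
  have e4 : ((t, w) : ℝ × E) = (t, 0) + (0, w) := by simp
  rw [e4, map_add]
  congr 1
  · exact (DFunLike.congr_fun e1 t).symm
  · exact (DFunLike.congr_fun e2 w).symm.trans (DFunLike.congr_fun e3 w)

/-- The local expression of the integrand is the contraction of that of `H^* σ` by `∂/∂s`. -/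
theorem homotopyIntegrand_compContinuousLinearMap_chart (σ : FormField E M (k + 1)) (p₀ : M) (s : ℝ)
    {y : E} (hy : y ∈ (extChartAt 𝓘(ℝ, E) p₀).target) :
    (homotopyIntegrand H σ s ((extChartAt 𝓘(ℝ, E) p₀).symm y)).compContinuousLinearMap
        (modelDeriv (E := E) (E' := E) (extChartAt 𝓘(ℝ, E) p₀).symm y) =
      contractLine E k (vectorPullback (chartHomotopy H p₀) σ (s, y)) := by
  ext w
  rw [contractLine_apply, vectorPullback, homotopyIntegrand, compContinuousLinearMap_apply,
    compContinuousLinearMap_apply, compContinuousLinearMap_apply, curryLeft_apply_apply]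
  congr 1
  funext i
  refine Fin.cases ?_ (fun i => ?_) i
  · simp [modelDeriv_chartHomotopy hH p₀ s hy]
  · simp [modelDeriv_chartHomotopy hH p₀ s hy]

theorem homotopyIntegrand_eq (σ : FormField E M (k + 1)) (s : ℝ) (p : M) :
    homotopyIntegrand H σ s p =
      (contractLine E k (vectorPullback (chartHomotopy H p) σ
        (s, extChartAt 𝓘(ℝ, E) p p))).compContinuousLinearMap
        (modelDeriv (E := E) (E' := E) (extChartAt 𝓘(ℝ, E) p) p) := by
  rw [← homotopyIntegrand_compContinuousLinearMap_chart hH σ p s (mem_extChartAt_target p)]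
  exact (inChart_compContinuousLinearMap (E := E) (homotopyIntegrand H σ s) p).symm

/-- The slice at `s` of the local expression of `H^* σ` is the local expression of `H_s^* σ`. -/
theorem restrictSlice_vectorPullback (σ : FormField E M k) (s : ℝ) (p : M) :
    (restrictSlice E k (vectorPullback (chartHomotopy H p) σ
        (s, extChartAt 𝓘(ℝ, E) p p))).compContinuousLinearMap
        (modelDeriv (E := E) (E' := E) (extChartAt 𝓘(ℝ, E) p) p) =
      formAt (pullback (H s) σ) p := by
  rw [← inChart_compContinuousLinearMap (pullback (H s) σ) p]
  congr 1
  ext w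
  rw [restrictSlice_apply, vectorPullback, inChart_apply, formAt_pullback,
    compContinuousLinearMap_apply, compContinuousLinearMap_apply, compContinuousLinearMap_apply]
  congr 1
  funext i
  simp only [Function.comp_apply]
  rw [modelDeriv_chartHomotopy hH p s (mem_extChartAt_target p), _root_.map_zero, zero_add]

theorem homotopyIntegrand_dForm {σ : FormField E M k} (hσ : IsSmoothForm σ) (s : ℝ) (p : M) :
    homotopyIntegrand H (dForm σ) s p =
      (contractLine E k (extDeriv (vectorPullback (chartHomotopy H p) σ)
        (s, extChartAt 𝓘(ℝ, E) p p))).compContinuousLinearMap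
        (modelDeriv (E := E) (E' := E) (extChartAt 𝓘(ℝ, E) p) p) := by
  rw [homotopyIntegrand_eq hH, extDeriv_vectorPullback
    (isOpen_univ.prod (isOpen_extChartAt_target p)) (contMDiffOn_chartHomotopy hH p) hσ
    ⟨mem_univ s, mem_extChartAt_target p⟩]

variable [FiniteDimensional ℝ E]

theorem contDiffOn_vectorPullback_chartHomotopy {σ : FormField E M k} (hσ : IsSmoothForm σ)
    (p₀ : M) :
    ContDiffOn ℝ ∞ (vectorPullback (chartHomotopy (E := E) H p₀) σ)
      (univ ×ˢ (extChartAt 𝓘(ℝ, E) p₀).target) :=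
  contDiffOn_vectorPullback (isOpen_univ.prod (isOpen_extChartAt_target p₀))
    (contMDiffOn_chartHomotopy hH p₀) hσ

theorem continuous_homotopyIntegrand {σ : FormField E M (k + 1)} (hσ : IsSmoothForm σ) (p : M) :
    Continuous fun s => homotopyIntegrand H σ s p := by
  simp_rw [homotopyIntegrand_eq hH σ _ p]
  have h1 := continuous_slice_of_continuousOn
    (contDiffOn_vectorPullback_chartHomotopy hH hσ p).continuousOn (mem_extChartAt_target p)
  exact ((compContinuousLinearMapCLM (modelDeriv (E := E) (E' := E)
    (extChartAt 𝓘(ℝ, E) p) p)).comp (contractLine E k)).continuous.comp h1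

/-- In a chart the homotopy operator is an integral depending on a parameter in a vector space. -/
theorem inChart_homotopyOp {σ : FormField E M (k + 1)} (hσ : IsSmoothForm σ) (p₀ : M) {y : E}
    (hy : y ∈ (extChartAt 𝓘(ℝ, E) p₀).target) :
    inChart p₀ (homotopyOp H σ) y =
      ∫ s in (0 : ℝ)..1, contractLine E k (vectorPullback (chartHomotopy H p₀) σ (s, y)) := by
  simp_rw [← homotopyIntegrand_compContinuousLinearMap_chart hH σ p₀ _ hy]
  rw [inChart_apply, formAt_homotopyOp]
  exact ((compContinuousLinearMapCLM (modelDeriv (E := E) (E' := E)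
    (extChartAt 𝓘(ℝ, E) p₀).symm y)).intervalIntegral_comp_comm
      ((continuous_homotopyIntegrand hH hσ
        ((extChartAt 𝓘(ℝ, E) p₀).symm y)).intervalIntegrable (μ := MeasureTheory.volume) 0 1)).symm

theorem contDiffOn_contractLine_vectorPullback {σ : FormField E M (k + 1)} (hσ : IsSmoothForm σ)
    (p₀ : M) :
    ContDiffOn ℝ ∞ (fun q => contractLine E k (vectorPullback (chartHomotopy H p₀) σ q))
      (univ ×ˢ (extChartAt 𝓘(ℝ, E) p₀).target) :=
  (contractLine E k).contDiff.comp_contDiffOn (contDiffOn_vectorPullback_chartHomotopy hH hσ p₀)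

theorem isSmoothForm_homotopyOp {σ : FormField E M (k + 1)} (hσ : IsSmoothForm σ) :
    IsSmoothForm (homotopyOp H σ) := fun p₀ =>
  (contDiffOn_integral_slice (isOpen_extChartAt_target p₀)
    (contDiffOn_contractLine_vectorPullback hH hσ p₀)).congr
    fun _ hy => inChart_homotopyOp hH hσ p₀ hy

theorem formAt_dForm_homotopyOp {σ : FormField E M (k + 1)} (hσ : IsSmoothForm σ) (p : M) :
    formAt (dForm (homotopyOp H σ)) p =
      (∫ s in (0 : ℝ)..1, extDeriv (fun y => contractLine E k
        (vectorPullback (chartHomotopy H p) σ (s, y)))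
          (extChartAt 𝓘(ℝ, E) p p)).compContinuousLinearMap
        (modelDeriv (E := E) (E' := E) (extChartAt 𝓘(ℝ, E) p) p) := by
  have hy := mem_extChartAt_target (I := 𝓘(ℝ, E)) p
  have hV := isOpen_extChartAt_target (I := 𝓘(ℝ, E)) p
  have hg := contDiffOn_contractLine_vectorPullback hH hσ p
  have heq : inChart p (homotopyOp H σ) =ᶠ[𝓝 (extChartAt 𝓘(ℝ, E) p p)] fun y =>
      ∫ s in (0 : ℝ)..1, contractLine E k (vectorPullback (chartHomotopy H p) σ (s, y)) := by
    filter_upwards [hV.mem_nhds hy] with y hy using inChart_homotopyOp hH hσ p hy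
  rw [formAt_dForm, heq.extDeriv_eq, extDeriv, (hasFDerivAt_integral_slice hV hg hy).fderiv]
  congr 1
  have hint := (continuous_slice_of_continuousOn
    (contDiffOn_fderiv_slice hV hg).continuousOn hy).intervalIntegrable (μ := MeasureTheory.volume)
      0 1
  refine ((alternatizeUncurryFinCLM ℝ E ℝ).intervalIntegral_comp_comm hint).symm.trans ?_
  congr 1
  funext s
  rw [extDeriv, (hasFDerivAt_slice hV hg s hy).fderiv]
  rfl

/-- The fundamental theorem of calculus for `s ↦ H_s^* σ`. -/
theorem integral_restrictSlice_fderiv {σ : FormField E M k} (hσ : IsSmoothForm σ) (p : M) :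
    (∫ s in (0 : ℝ)..1, restrictSlice E k (fderiv ℝ (vectorPullback (chartHomotopy H p) σ)
        (s, extChartAt 𝓘(ℝ, E) p p) (1, 0))).compContinuousLinearMap
        (modelDeriv (E := E) (E' := E) (extChartAt 𝓘(ℝ, E) p) p) =
      formAt (pullback (H 1) σ) p - formAt (pullback (H 0) σ) p := by
  have hy := mem_extChartAt_target (I := 𝓘(ℝ, E)) p
  have hU := isOpen_univ (X := ℝ) |>.prod (isOpen_extChartAt_target (I := 𝓘(ℝ, E)) p)
  have hτ := contDiffOn_vectorPullback_chartHomotopy hH hσ p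
  have hcont : Continuous fun s => restrictSlice E k
      (fderiv ℝ (vectorPullback (chartHomotopy H p) σ) (s, extChartAt 𝓘(ℝ, E) p p) (1, 0)) := by
    have h1 := continuous_slice_of_continuousOn
      (hτ.fderiv_of_isOpen hU (m := ∞) (by simp)).continuousOn hy
    fun_prop
  rw [intervalIntegral.integral_eq_sub_of_hasDerivAt (fun s _ => hasDerivAt_restrictSlice
      ((hτ.contDiffAt (hU.mem_nhds ⟨mem_univ s, hy⟩)).differentiableAt (by simp)))
      (hcont.intervalIntegrable 0 1),
    ← restrictSlice_vectorPullback hH σ 1 p, ← restrictSlice_vectorPullback hH σ 0 p]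
  rfl

theorem continuous_contractLine_extDeriv {σ : FormField E M k} (hσ : IsSmoothForm σ) (p : M) :
    Continuous fun s => contractLine E k (extDeriv (vectorPullback (chartHomotopy H p) σ)
        (s, extChartAt 𝓘(ℝ, E) p p)) := by
  have h1 := continuous_slice_of_continuousOn
    ((contDiffOn_vectorPullback_chartHomotopy hH hσ p).fderiv_of_isOpen (isOpen_univ.prod
      (isOpen_extChartAt_target p)) (m := ∞) (by simp)).continuousOn (mem_extChartAt_target p)
  exact ((contractLine E k).comp (alternatizeUncurryFinCLM ℝ (ℝ × E) ℝ)).continuous.comp h1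

theorem formAt_homotopyOp_dForm {σ : FormField E M k} (hσ : IsSmoothForm σ) (p : M) :
    formAt (homotopyOp H (dForm σ)) p =
      (∫ s in (0 : ℝ)..1, contractLine E k (extDeriv (vectorPullback (chartHomotopy H p) σ)
        (s, extChartAt 𝓘(ℝ, E) p p))).compContinuousLinearMap
        (modelDeriv (E := E) (E' := E) (extChartAt 𝓘(ℝ, E) p) p) := by
  rw [formAt_homotopyOp]
  simp_rw [homotopyIntegrand_dForm hH hσ]
  exact (compContinuousLinearMapCLM (modelDeriv (E := E) (E' := E)
    (extChartAt 𝓘(ℝ, E) p) p)).intervalIntegral_comp_comm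
      ((continuous_contractLine_extDeriv hH hσ p).intervalIntegrable
        (μ := MeasureTheory.volume) 0 1)

theorem homotopyOp_dForm_zero {σ : FormField E M 0} (hσ : IsSmoothForm σ) :
    homotopyOp H (dForm σ) = pullback (H 1) σ - pullback (H 0) σ := by
  refine formField_ext fun p => ?_
  rw [formAt_homotopyOp_dForm hH hσ]
  refine Eq.trans ?_ (integral_restrictSlice_fderiv hH hσ p)
  simp_rw [contractLine_extDeriv_zero]

/-- The homotopy formula `d h + h d = H_1^* - H_0^*`. -/
theorem dForm_homotopyOp_add_homotopyOp_dForm {σ : FormField E M (k + 1)} (hσ : IsSmoothForm σ) :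
    dForm (homotopyOp H σ) + homotopyOp H (dForm σ) = pullback (H 1) σ - pullback (H 0) σ := by
  refine formField_ext fun p => ?_
  have hy := mem_extChartAt_target (I := 𝓘(ℝ, E)) p
  have hV := isOpen_extChartAt_target (I := 𝓘(ℝ, E)) p
  have hg := contDiffOn_contractLine_vectorPullback hH hσ p
  have hτ := contDiffOn_vectorPullback_chartHomotopy hH hσ p
  have hc : Continuous fun s => extDeriv (fun y => contractLine E k
      (vectorPullback (chartHomotopy H p) σ (s, y))) (extChartAt 𝓘(ℝ, E) p p) := by
    have h1 := continuous_slice_of_continuousOn (contDiffOn_fderiv_slice hV hg).continuousOn hy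
    simp_rw [extDeriv, (hasFDerivAt_slice hV hg _ hy).fderiv]
    exact (alternatizeUncurryFinCLM ℝ E ℝ).continuous.comp h1
  change formAt (dForm (homotopyOp H σ)) p + formAt (homotopyOp H (dForm σ)) p = _
  refine Eq.trans ?_ (integral_restrictSlice_fderiv hH hσ p)
  rw [formAt_homotopyOp_dForm hH hσ, formAt_dForm_homotopyOp hH hσ]
  simp_rw [← contractLine_extDeriv_succ ((hτ.contDiffAt
    ((isOpen_univ.prod hV).mem_nhds ⟨mem_univ _, hy⟩)).differentiableAt (by simp))]
  rw [intervalIntegral.integral_add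
    ((continuous_contractLine_extDeriv hH hσ p).intervalIntegrable 0 1)
    (hc.intervalIntegrable 0 1)]
  exact add_comm _ _

end Homotopy
/-! ### Linearity of the homotopy operator -/

section Linear

universe u

variable {E : Type u} [NormedAddCommGroup E] [NormedSpace ℝ E]
  {M : Type*} [TopologicalSpace M] [ChartedSpace E M] {k : ℕ} {H : ℝ → M → M}

theorem homotopyOp_add {σ τ : FormField E M (k + 1)}
    (hσ : ∀ p, Continuous fun s => homotopyIntegrand H σ s p)
    (hτ : ∀ p, Continuous fun s => homotopyIntegrand H τ s p) :
    homotopyOp H (σ + τ) = homotopyOp H σ + homotopyOp H τ := by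
  refine formField_ext fun p => ?_
  exact intervalIntegral.integral_add ((hσ p).intervalIntegrable 0 1)
    ((hτ p).intervalIntegrable 0 1)

theorem homotopyOp_smul (c : ℝ) (σ : FormField E M (k + 1)) :
    homotopyOp H (c • σ) = c • homotopyOp H σ := by
  refine formField_ext fun p => ?_
  exact intervalIntegral.integral_smul (μ := MeasureTheory.volume) (a := 0) (b := 1) c
    fun s => homotopyIntegrand H σ s p

theorem pullback_smul (c : ℝ) (F : M → M) (σ : FormField E M k) :
    pullback (E := E) F (c • σ) = c • pullback (E := E) F σ := rfl

theorem dForm_smul (c : ℝ) (σ : FormField E M k) : dForm (c • σ) = c • dForm σ := by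
  refine formField_ext fun p => ?_
  have h : inChart p (c • σ) = c • inChart p σ := rfl
  rw [formAt_dForm, h, extDeriv_smul]
  rfl

theorem dForm_zero : dForm (0 : FormField E M k) = 0 := by
  simpa using dForm_smul 0 (0 : FormField E M k)

variable [IsManifold 𝓘(ℝ, E) ∞ M] [FiniteDimensional ℝ E]

/-- The homotopy operator as a linear map between spaces of smooth forms. -/
noncomputable def homotopyLinearMap
    (hH : ContMDiff (𝓘(ℝ, ℝ).prod 𝓘(ℝ, E)) 𝓘(ℝ, E) ∞ (fun q : ℝ × M => H q.1 q.2)) (k : ℕ) :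
    Ω E M (k + 1) →ₗ[ℝ] Ω E M k where
  toFun σ := ⟨homotopyOp H σ, isSmoothForm_homotopyOp hH σ.2⟩
  map_add' σ τ := Subtype.ext <| homotopyOp_add
    (continuous_homotopyIntegrand hH σ.2) (continuous_homotopyIntegrand hH τ.2)
  map_smul' c σ := Subtype.ext <| homotopyOp_smul c (σ : FormField E M (k + 1))

theorem coe_homotopyLinearMap
    (hH : ContMDiff (𝓘(ℝ, ℝ).prod 𝓘(ℝ, E)) 𝓘(ℝ, E) ∞ (fun q : ℝ × M => H q.1 q.2))
    (σ : Ω E M (k + 1)) :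
    (homotopyLinearMap hH k σ : FormField E M k) = homotopyOp H (σ : FormField E M (k + 1)) := rfl

end Linear

/-! ### Contractions -/

section Contraction

variable {E : Type*} [NormedAddCommGroup E] [NormedSpace ℝ E]

/-- The contraction of an alternating form by a tuple of vectors. -/
noncomputable def contractAt {k m N : ℕ} (h : k + m = N) (v : Fin k → E) :
    (E [⋀^Fin N]→L[ℝ] ℝ) →ₗ[ℝ] E [⋀^Fin m]→L[ℝ] ℝ where
  toFun f := contract (M := E) h (fun a _ => v a) (fun _ => f) 0
  map_add' _ _ := rfl
  map_smul' _ _ := rfl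

theorem contractAt_apply {k m N : ℕ} (h : k + m = N) (v : Fin k → E) (f : E [⋀^Fin N]→L[ℝ] ℝ)
    (w : Fin m → E) :
    contractAt h v f w = f (fun i => Fin.append v w (Fin.cast h.symm i)) := rfl

theorem formAt_contract {M : Type*} [TopologicalSpace M] [ChartedSpace E M] {k m N : ℕ}
    (h : k + m = N) (v : Fin k → VField E M) (σ : FormField E M N) (p : M) :
    formAt (contract h v σ) p = contractAt h (fun a => vectorAt (v a) p) (formAt σ p) := rfl

/-- The head of the second of two concatenated tuples is inserted at position `k`. -/
theorem append_vecCons {V : Type*} {k m : ℕ} (v : Fin k → V) (X : V) (w : Fin m → V) :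
    (fun i : Fin (k + m + 1) => Fin.append v (Matrix.vecCons X w) i) =
      Fin.insertNth (α := fun _ => V) (⟨k, by omega⟩ : Fin (k + m + 1)) X (Fin.append v w) := by
  refine Fin.eq_insertNth_iff.2 ⟨?_, ?_⟩
  · have : (⟨k, by omega⟩ : Fin (k + (m + 1))) = Fin.natAdd k 0 := by ext; simp
    simp only [this]
    rw [Fin.append_right]
    rfl
  · funext j
    refine Fin.addCases (fun a => ?_) (fun b => ?_) j
    · have : (⟨k, by omega⟩ : Fin (k + m + 1)).succAbove (Fin.castAdd m a) =
          (Fin.castAdd (m + 1) a : Fin (k + (m + 1))) := by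
        ext
        simp [Fin.succAbove, Fin.lt_def]
      rw [Fin.removeNth, this, Fin.append_left, Fin.append_left]
    · have : (⟨k, by omega⟩ : Fin (k + m + 1)).succAbove (Fin.natAdd k b) =
          (Fin.natAdd k b.succ : Fin (k + (m + 1))) := by
        ext
        simp [Fin.succAbove, Fin.lt_def]
        omega
      rw [Fin.removeNth, this, Fin.append_right, Fin.append_right]
      rfl

/-- Moving a vector past `k` other vectors gives the sign `(-1)^k`. -/
theorem curryLeft_contractAt {k m N : ℕ} (h : k + (m + 1) = N + 1) (h' : k + m = N)
    (v : Fin k → E) (f : E [⋀^Fin (N + 1)]→L[ℝ] ℝ) (X : E) :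
    (contractAt h v f).curryLeft X = (-1 : ℝ) ^ k • contractAt h' v (f.curryLeft X) := by
  subst h'
  ext w
  rw [curryLeft_apply_apply, contractAt_apply, ContinuousAlternatingMap.smul_apply,
    contractAt_apply, curryLeft_apply_apply]
  simp only [Fin.cast_refl, id]
  have := f.map_insertNth (⟨k, by omega⟩ : Fin (k + m + 1)) X (Fin.append v w)
  rw [← append_vecCons] at this
  refine this.trans ?_
  simp

theorem contractAt_compContinuousLinearMap {E' : Type*} [NormedAddCommGroup E'] [NormedSpace ℝ E']
    {k m N : ℕ} (h : k + m = N) (v : Fin k → E') (f : E [⋀^Fin N]→L[ℝ] ℝ) (A : E' →L[ℝ] E) :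
    contractAt h v (f.compContinuousLinearMap A) =
      (contractAt h (fun a => A (v a)) f).compContinuousLinearMap A := by
  subst h
  ext w
  simp only [compContinuousLinearMap_apply, contractAt_apply, Fin.cast_refl, id]
  congr 1
  funext i
  refine Fin.addCases (fun a => ?_) (fun b => ?_) i <;> simp

end Contraction

/-! ### Equivariant homotopies -/

section Equivariant

universe u

variable {E : Type u} [NormedAddCommGroup E] [NormedSpace ℝ E]
  {M : Type*} [TopologicalSpace M] [ChartedSpace E M]
  {H : ℝ → M → M}

theorem homotopyIntegrand_contract {k m N : ℕ} (h : k + (m + 1) = N + 1) (h' : k + m = N)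
    {v : Fin k → VField E M}
    (hv : ∀ s p a, modelDeriv (E := E) (E' := E) (H s) p (vectorAt (v a) p) = vectorAt (v a) (H s p))
    (σ : FormField E M (N + 1)) (s : ℝ) (p : M) :
    homotopyIntegrand H (contract h v σ) s p =
      (-1 : ℝ) ^ k • contractAt h' (fun a => vectorAt (v a) p) (homotopyIntegrand H σ s p) := by
  rw [homotopyIntegrand, homotopyIntegrand, formAt_contract, curryLeft_contractAt h h',
    contractAt_compContinuousLinearMap]
  simp only [hv]
  rfl

section

variable [IsManifold 𝓘(ℝ, E) ∞ M] [FiniteDimensional ℝ E]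
  (hH : ContMDiff (𝓘(ℝ, ℝ).prod 𝓘(ℝ, E)) 𝓘(ℝ, E) ∞ (fun q : ℝ × M => H q.1 q.2))
  {k m N : ℕ} (h : k + (m + 1) = N + 1) (h' : k + m = N) {v : Fin k → VField E M}
  (hv : ∀ s p a, modelDeriv (E := E) (E' := E) (H s) p (vectorAt (v a) p) = vectorAt (v a) (H s p))
  {σ : FormField E M (N + 1)} (hσ : IsSmoothForm σ)

include hH h' hv hσ

theorem continuous_homotopyIntegrand_contract (p : M) :
    Continuous fun s => homotopyIntegrand H (contract h v σ) s p := by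
  simp_rw [homotopyIntegrand_contract h h' hv]
  exact ((contractAt h' fun a => vectorAt (v a) p).continuous_of_finiteDimensional.comp
    (continuous_homotopyIntegrand hH hσ p)).const_smul ((-1 : ℝ) ^ k)

/-- The homotopy operator commutes up to sign with contractions by vector fields preserved by the
homotopy. -/
theorem homotopyOp_contract :
    homotopyOp H (contract h v σ) = (-1 : ℝ) ^ k • contract h' v (homotopyOp H σ) := by
  refine formField_ext fun p => ?_
  rw [formAt_homotopyOp]
  simp_rw [homotopyIntegrand_contract h h' hv]
  rw [intervalIntegral.integral_smul]
  have := ((contractAt h' fun a => vectorAt (v a) p).toContinuousLinearMap).intervalIntegral_comp_comm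
    ((continuous_homotopyIntegrand hH hσ p).intervalIntegrable (μ := MeasureTheory.volume) 0 1)
  exact congrArg (fun f => (-1 : ℝ) ^ k • f) this

end

variable {G : Type*} [Group G] [MulAction G M]

theorem isInvariantForm_homotopyOp [IsManifold 𝓘(ℝ, E) ∞ M] [FiniteDimensional ℝ E]
    (hH : ContMDiff (𝓘(ℝ, ℝ).prod 𝓘(ℝ, E)) 𝓘(ℝ, E) ∞ (fun q : ℝ × M => H q.1 q.2))
    (hsmul : ∀ (g : G) (p : M), MDifferentiableAt 𝓘(ℝ, E) 𝓘(ℝ, E) (fun p : M => g • p) p)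
    (hG : ∀ s (g : G) (p : M), H s (g • p) = g • H s p) {k : ℕ} {σ : FormField E M (k + 1)}
    (hσ : IsSmoothForm σ) (hinv : IsInvariantForm G σ) :
    IsInvariantForm G (homotopyOp H σ) := by
  intro g
  have hg := hsmul g
  refine formField_ext fun p => ?_
  rw [formAt_pullback, formAt_homotopyOp, formAt_homotopyOp]
  refine ((compContinuousLinearMapCLM (modelDeriv (E := E) (E' := E)
    (fun p : M => g • p) p)).intervalIntegral_comp_comm
      ((continuous_homotopyIntegrand hH hσ (g • p)).intervalIntegrable
        (μ := MeasureTheory.volume) 0 1)).symm.trans ?_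
  congr 1
  funext s
  have e1 : modelDeriv (E := ℝ) (E' := E) (fun s => H s (g • p)) s =
      (modelDeriv (E := E) (E' := E) (fun p : M => g • p) (H s p)).comp
        (modelDeriv (E := ℝ) (E' := E) (fun s => H s p) s) := by
    simp only [hG]
    exact modelDeriv_comp (g := fun p : M => g • p) (f := fun s => H s p) (hg _)
      (mdifferentiableAt_path hH s p)
  have e2 : (modelDeriv (E := E) (E' := E) (H s) (g • p)).comp
        (modelDeriv (E := E) (E' := E) (fun p : M => g • p) p) =
      (modelDeriv (E := E) (E' := E) (fun p : M => g • p) (H s p)).comp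
        (modelDeriv (E := E) (E' := E) (H s) p) := by
    rw [← modelDeriv_comp (g := H s) (f := fun p : M => g • p) (mdifferentiableAt_slice hH s _)
      (hg p), ← modelDeriv_comp (g := fun p : M => g • p) (f := H s) (hg _)
      (mdifferentiableAt_slice hH s p)]
    simp only [hG]
  have e3 : formAt σ (H s p) = (formAt σ (g • H s p)).compContinuousLinearMap
      (modelDeriv (E := E) (E' := E) (fun p : M => g • p) (H s p)) := by
    rw [← formAt_pullback, hinv g]
  rw [homotopyIntegrand, e1, hG, homotopyIntegrand, e3, curryLeft_compContinuousLinearMap]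
  change (((formAt σ (g • H s p)).curryLeft _).compContinuousLinearMap _).compContinuousLinearMap _
    = _
  ext w
  have e4 := fun u => DFunLike.congr_fun e2 u
  simp only [ContinuousLinearMap.comp_apply] at e4
  simp only [compContinuousLinearMap_apply, Function.comp_def, e4, ContinuousLinearMap.comp_apply]

variable {EG : Type*} [NormedAddCommGroup EG] [NormedSpace ℝ EG]
  [TopologicalSpace G] [ChartedSpace EG G]
  [ContMDiffSMul 𝓘(ℝ, EG) 𝓘(ℝ, E) ∞ G M]

/-- An equivariant map preserves the infinitesimal generators of the action. -/
theorem modelDeriv_infGen {f : M → M} {p : M} (hf : MDifferentiableAt 𝓘(ℝ, E) 𝓘(ℝ, E) f p)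
    (hG : ∀ (g : G) (p : M), f (g • p) = g • f p) (x : GroupLieAlgebra 𝓘(ℝ, EG) G) :
    modelDeriv (E := E) (E' := E) f p (vectorAt (infGen x) p) = vectorAt (infGen x) (f p) := by
  have hs : ∀ q : M, MDifferentiableAt 𝓘(ℝ, EG) 𝓘(ℝ, E) (fun g : G => g • q) 1 := fun q =>
    (ContMDiff.smul (contMDiff_id (n := ∞)) contMDiff_const).mdifferentiableAt (by simp)
  have h1 := modelDeriv_comp (E := EG) (E' := E) (E'' := E) (p := (1 : G)) (g := f)
    (f := fun g : G => g • p) (by simpa using hf) (hs p)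
  simp only [hG, one_smul] at h1
  have hx : ∀ q : M, vectorAt (infGen x) q =
      -modelDeriv (E := EG) (E' := E) (fun g : G => g • q) 1 x := fun _ => rfl
  rw [hx, hx, _root_.map_neg, h1]
  rfl

end Equivariant
end HomotopyMoment

namespace HomotopyMoment

/-! ### The Chevalley–Eilenberg differential and the signs -/

section Signs

theorem dCE_map {𝔤 V W : Type*} [Bracket 𝔤 𝔤] [AddCommGroup V] [Module ℝ V] [AddCommGroup W]
    [Module ℝ W] {k : ℕ} (L : V →ₗ[ℝ] W) (F : (Fin (k + 1) → 𝔤) → V) (x : Fin (k + 2) → 𝔤) :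
    dCE (fun y => L (F y)) x = L (dCE F x) := by
  simp only [dCE, map_sum, apply_ite L, map_smul, map_zero]

theorem dCE_zero {𝔤 V : Type*} [Bracket 𝔤 𝔤] [AddCommGroup V] [Module ℝ V] {k : ℕ}
    (x : Fin (k + 2) → 𝔤) : dCE (fun _ : Fin (k + 1) → 𝔤 => (0 : V)) x = 0 := by
  simp [dCE]

theorem dCE_smul {𝔤 V : Type*} [Bracket 𝔤 𝔤] [AddCommGroup V] [Module ℝ V] {k : ℕ} (c : ℝ)
    (F : (Fin (k + 1) → 𝔤) → V) (x : Fin (k + 2) → 𝔤) :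
    dCE (fun y => c • F y) x = c • dCE F x := by
  have h := dCE_map (c • LinearMap.id) F x
  simpa only [LinearMap.smul_apply, LinearMap.id_apply] using h

theorem varsig_mul_self (k : ℕ) : varsig k * varsig k = 1 := by
  simp [varsig, ← mul_pow]

theorem varsig_succ (k : ℕ) : varsig (k + 1) = (-1) ^ (k + 1) * varsig k := by
  have : (k + 1) * (k + 1 + 1) / 2 = (k + 1) + k * (k + 1) / 2 := by
    rw [show (k + 1) * (k + 1 + 1) = k * (k + 1) + (k + 1) * 2 by ring,
      Nat.add_mul_div_right _ _ two_pos, add_comm]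
  rw [varsig, varsig, this, pow_add]
  ring

theorem varsig_one : varsig 1 = 1 := by simp [varsig]

end Signs

/-! ### The equation `d_tot φ = ω̃` -/

section MomentMap

variable {E : Type*} [NormedAddCommGroup E] [NormedSpace ℝ E]
  {M : Type*} [TopologicalSpace M] [ChartedSpace E M]
  {EG : Type*} [NormedAddCommGroup EG] [NormedSpace ℝ EG]
  {G : Type*} [TopologicalSpace G] [ChartedSpace EG G] [Group G]

theorem coe_toCochain (f : BiCochain E M EG G) (k j : ℕ)
    (x : Fin k → GroupLieAlgebra 𝓘(ℝ, EG) G) :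
    (toCochain f k j x : FormField E M j) = varsig k • (f k j x : FormField E M j) := rfl

theorem isSmoothForm_dCE {k j : ℕ}
    (F : (Fin (k + 1) → GroupLieAlgebra 𝓘(ℝ, EG) G) → Ω E M j)
    (x : Fin (k + 2) → GroupLieAlgebra 𝓘(ℝ, EG) G) :
    IsSmoothForm (dCE (fun y => (F y : FormField E M j)) x) := by
  have h := dCE_map (Ω E M j).subtype F x
  simp only [Submodule.subtype_apply] at h
  rw [h]
  exact (dCE F x).2

variable [MulAction G M]
  {n : ℕ} {σ : FormField E M (n + 1)} {f : BiCochain E M EG G}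

/-- The component of degree one of `d_tot φ = ω̃`. -/
theorem dForm_toCochain_one (hf : IsMomentMap n σ f) (j : ℕ) (h : 1 + j = n)
    (x : Fin 1 → GroupLieAlgebra 𝓘(ℝ, EG) G) :
    dForm (toCochain f 1 j x : FormField E M j) =
      -contract (k := 1) (m := j + 1) (by omega) (fun a => infGen (x a)) σ := by
  have hx : x = fun _ => x 0 := by
    funext a
    rw [Subsingleton.elim a 0]
  rw [coe_toCochain, varsig_one, one_smul, hx]
  exact hf.first j h (x 0)

/-- The components of degree at least two of `d_tot φ = ω̃`; the two signs `ς` combine to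
`ς(k) ς(k - 1) = (-1)^k`. -/
theorem dForm_toCochain_add_two (hf : IsMomentMap n σ f) (k j : ℕ) (h : k + 2 + j = n)
    (x : Fin (k + 2) → GroupLieAlgebra 𝓘(ℝ, EG) G) :
    dForm (toCochain f (k + 2) j x : FormField E M j) =
      (-1 : ℝ) • contract (k := k + 2) (m := j + 1) (by omega) (fun a => infGen (x a)) σ +
        (-1 : ℝ) ^ (k + 1) •
          dCE (fun y => (toCochain f (k + 1) (j + 1) y : FormField E M (j + 1))) x := by
  have h1 := eq_sub_of_add_eq (hf.middle k j h x).symm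
  simp only [coe_toCochain, dCE_smul]
  rw [dForm_smul, h1, smul_sub, smul_smul, varsig_mul_self, varsig_succ (k + 1)]
  module

end MomentMap

/-! ### The equivalence defined by an equivariant homotopy -/

section Equivalence

universe u

variable {E : Type u} [NormedAddCommGroup E] [NormedSpace ℝ E] [FiniteDimensional ℝ E]
  {M : Type*} [TopologicalSpace M] [ChartedSpace E M] [IsManifold 𝓘(ℝ, E) ∞ M]
  {EG : Type*} [NormedAddCommGroup EG] [NormedSpace ℝ EG]
  {G : Type*} [TopologicalSpace G] [ChartedSpace EG G] [Group G]
  {H : ℝ → M → M}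

/-- The element `η = ∑_k (-1)^{k+1} h φ_k`, where `h` is the homotopy operator. -/
noncomputable def homotopyCochain
    (hH : ContMDiff (𝓘(ℝ, ℝ).prod 𝓘(ℝ, E)) 𝓘(ℝ, E) ∞ (fun q : ℝ × M => H q.1 q.2))
    (φ : BiCochain E M EG G) : BiCochain E M EG G :=
  fun k j => (-1 : ℝ) ^ (k + 1) • (homotopyLinearMap hH j).compAlternatingMap (φ k (j + 1))

theorem coe_homotopyCochain
    (hH : ContMDiff (𝓘(ℝ, ℝ).prod 𝓘(ℝ, E)) 𝓘(ℝ, E) ∞ (fun q : ℝ × M => H q.1 q.2))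
    (φ : BiCochain E M EG G) (k j : ℕ) (x : Fin k → GroupLieAlgebra 𝓘(ℝ, EG) G) :
    (homotopyCochain hH φ k j x : FormField E M j) =
      (-1 : ℝ) ^ (k + 1) • homotopyOp H (φ k (j + 1) x : FormField E M (j + 1)) := rfl

theorem dCE_homotopyOp
    (hH : ContMDiff (𝓘(ℝ, ℝ).prod 𝓘(ℝ, E)) 𝓘(ℝ, E) ∞ (fun q : ℝ × M => H q.1 q.2)) {k j : ℕ}
    (F : (Fin (k + 1) → GroupLieAlgebra 𝓘(ℝ, EG) G) → Ω E M (j + 1))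
    (x : Fin (k + 2) → GroupLieAlgebra 𝓘(ℝ, EG) G) :
    dCE (fun y => homotopyOp H (F y : FormField E M (j + 1))) x =
      homotopyOp H (dCE (fun y => (F y : FormField E M (j + 1))) x) := by
  have h1 := dCE_map ((Ω E M j).subtype.comp (homotopyLinearMap hH j)) F x
  have h2 := dCE_map (Ω E M (j + 1)).subtype F x
  simp only [LinearMap.comp_apply, Submodule.subtype_apply, coe_homotopyLinearMap] at h1 h2
  rw [h1, h2]

variable [MulAction G M] [ContMDiffSMul 𝓘(ℝ, EG) 𝓘(ℝ, E) ∞ G M]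

/-- An equivariant homotopy identifies a homotopy moment map, up to equivalence, with its pullback
under the end of the homotopy. -/
theorem momentEquivalent_of_homotopy
    (hH : ContMDiff (𝓘(ℝ, ℝ).prod 𝓘(ℝ, E)) 𝓘(ℝ, E) ∞ (fun q : ℝ × M => H q.1 q.2))
    (hG : ∀ s (g : G) (p : M), H s (g • p) = g • H s p) (h0 : ∀ p, H 0 p = p) {n : ℕ}
    {σ₀ : FormField E M (n + 1)} {f₀ : BiCochain E M EG G} {σ₁ : Ω E M (n + 1)}
    {f₁ : BiCochain E M EG G} (hσ : dForm (σ₁ : FormField E M (n + 1)) = 0)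
    (hinv : IsInvariantForm G (σ₁ : FormField E M (n + 1)))
    (hpull : pullback (H 1) (σ₁ : FormField E M (n + 1)) = σ₀)
    (hf₀ : HasTotalDegree n f₀) (hf₁ : IsMomentMap n (σ₁ : FormField E M (n + 1)) f₁)
    (hf : ∀ (k j : ℕ), 1 ≤ k → k + j = n → ∀ x : Fin k → GroupLieAlgebra 𝓘(ℝ, EG) G,
      pullback (H 1) (f₁ k j x : FormField E M j) = (f₀ k j x : FormField E M j)) :
    MomentEquivalent σ₀ f₀ (σ₁ : FormField E M (n + 1)) f₁ := by
  have hpull0 : ∀ {k : ℕ} (τ : FormField E M k), pullback (H 0) τ = τ := by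
    intro k τ
    have h : H 0 = fun p => p := funext h0
    refine formField_ext fun p => ?_
    rw [h, formAt_pullback, modelDeriv_id]
    rfl
  have hv : ∀ s p (x : GroupLieAlgebra 𝓘(ℝ, EG) G),
      modelDeriv (E := E) (E' := E) (H s) p (vectorAt (infGen x) p) =
        vectorAt (infGen x) (H s p) := fun s p x =>
    modelDeriv_infGen (mdifferentiableAt_slice hH s p) (hG s) x
  have hsmul : ∀ (g : G) (p : M), MDifferentiableAt 𝓘(ℝ, E) 𝓘(ℝ, E) (fun p : M => g • p) p :=
    fun g _ => (ContMDiffSMul.contMDiff_const_smul (I := 𝓘(ℝ, EG)) (n := ∞) g).mdifferentiableAt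
      (by simp)
  -- Outside total degree `n` the components of `φ¹` and `φ⁰` vanish.
  have hdeg : ∀ k j, ¬(1 ≤ k ∧ k + j = n) → ∀ x : Fin k → GroupLieAlgebra 𝓘(ℝ, EG) G,
      (toCochain f₁ k j x : FormField E M j) = 0 ∧
        (toCochain f₀ k j x : FormField E M j) = 0 := by
    intro k j hkj x
    simp [coe_toCochain, hf₀ k j hkj, hf₁.degree k j hkj]
  -- In particular the components of `η` outside total degree `n - 1` vanish.
  have hη : HasTotalDegree (n - 1) (homotopyCochain hH (toCochain f₁)) := by
    intro k j hkj
    ext x : 1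
    apply Subtype.ext
    rw [coe_homotopyCochain, (hdeg k (j + 1) (by omega) x).1]
    have := homotopyOp_smul (H := H) 0 (0 : FormField E M (j + 1))
    rw [zero_smul, zero_smul] at this
    rw [this, smul_zero]
    rfl
  have hdiff : ∀ k j, 1 ≤ k → k + j = n → ∀ x : Fin k → GroupLieAlgebra 𝓘(ℝ, EG) G,
      (toCochain f₁ k j x : FormField E M j) - (toCochain f₀ k j x : FormField E M j) =
        -(pullback (H 1) (toCochain f₁ k j x : FormField E M j) -
          pullback (H 0) (toCochain f₁ k j x : FormField E M j)) := by
    intro k j hk hkj x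
    rw [hpull0, coe_toCochain, coe_toCochain, pullback_smul, hf k j hk hkj, neg_sub]
  have hcontr : ∀ {k j : ℕ} (h : k + (j + 1) = n + 1) (h' : k + j = n)
      (x : Fin k → GroupLieAlgebra 𝓘(ℝ, EG) G),
      homotopyOp H (contract h (fun a => infGen (x a)) (σ₁ : FormField E M (n + 1))) =
        (-1 : ℝ) ^ k • contract h' (fun a => infGen (x a))
          (homotopyOp H (σ₁ : FormField E M (n + 1))) := fun h h' x =>
    homotopyOp_contract hH h h' (fun s p a => hv s p (x a)) σ₁.2
  have htilde : ∀ {k j : ℕ} (h : k + 1 + j = n) (x : Fin (k + 1) → GroupLieAlgebra 𝓘(ℝ, EG) G),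
      tilde ((-homotopyLinearMap hH n σ₁ : Ω E M n) : FormField E M n) (k + 1) j x =
        (-1 : ℝ) ^ (k + 1) • contract h (fun a => infGen (x a))
          (homotopyOp H (σ₁ : FormField E M (n + 1))) := by
    intro k j h x
    have hneg : contract h (fun a => infGen (x a))
        ((-homotopyLinearMap hH n σ₁ : Ω E M n) : FormField E M n) =
          -contract h (fun a => infGen (x a)) (homotopyOp H (σ₁ : FormField E M (n + 1))) := rfl
    rw [tilde, dif_pos ⟨by omega, h⟩, Nat.add_sub_cancel, hneg, pow_succ]
    module
  -- `h d φ_k`, from `d φ_k = -ω_k + (-1)^{k-1} d_𝔤 φ_{k-1}`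
  have hφ1 : ∀ j (h : 1 + j = n) (x : Fin 1 → GroupLieAlgebra 𝓘(ℝ, EG) G),
      homotopyOp H (dForm (toCochain f₁ 1 j x : FormField E M j)) =
        contract h (fun a => infGen (x a)) (homotopyOp H (σ₁ : FormField E M (n + 1))) := by
    intro j h x
    rw [dForm_toCochain_one hf₁ j h, ← neg_one_smul ℝ, homotopyOp_smul, hcontr _ h, smul_smul]
    simp
  have hφ2 : ∀ k j (h : k + 2 + j = n) (x : Fin (k + 2) → GroupLieAlgebra 𝓘(ℝ, EG) G),
      homotopyOp H (dForm (toCochain f₁ (k + 2) j x : FormField E M j)) =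
        (-1 : ℝ) ^ (k + 1) • contract h (fun a => infGen (x a))
          (homotopyOp H (σ₁ : FormField E M (n + 1))) -
        dCE (fun y => (homotopyCochain hH (toCochain f₁) (k + 1) j y : FormField E M j)) x := by
    intro k j h x
    -- Continuity in `s` makes the integrals below additive.
    have hs1 : ∀ (c : ℝ) {i : ℕ} (τ : FormField E M (i + 1)),
        (∀ p, Continuous fun s => homotopyIntegrand H τ s p) →
        ∀ p, Continuous fun s => homotopyIntegrand H (c • τ) s p :=
      fun c _ τ hτ p => (hτ p).const_smul c
    rw [dForm_toCochain_add_two hf₁ k j h, homotopyOp_add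
      (hs1 _ _ (continuous_homotopyIntegrand_contract hH _ h (fun s p a => hv s p (x a)) σ₁.2))
      (hs1 _ _ (continuous_homotopyIntegrand hH (isSmoothForm_dCE _ x))),
      homotopyOp_smul, homotopyOp_smul, hcontr _ h, ← dCE_homotopyOp hH]
    simp only [coe_homotopyCochain, dCE_smul]
    module
  refine ⟨homotopyCochain hH (toCochain f₁), -homotopyLinearMap hH n σ₁, hη, ?_, ?_, ?_⟩
  · intro g
    have h := isInvariantForm_homotopyOp hH hsmul hG σ₁.2 hinv g
    refine Eq.trans ?_ (congrArg Neg.neg h)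
    rfl
  · have h := dForm_homotopyOp_add_homotopyOp_dForm hH σ₁.2
    have hz := homotopyOp_smul (H := H) 0 (0 : FormField E M (n + 1 + 1))
    rw [zero_smul, zero_smul] at hz
    rw [hσ, hz, add_zero, hpull, hpull0] at h
    have hneg : ((-homotopyLinearMap hH n σ₁ : Ω E M n) : FormField E M n) =
        (-1 : ℝ) • homotopyOp H (σ₁ : FormField E M (n + 1)) := by
      rw [Submodule.coe_neg, coe_homotopyLinearMap]
      module
    rw [hneg, dForm_smul, h]
    module
  · intro k j x
    by_cases hkj : 1 ≤ k ∧ k + j = n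
    · rw [hdiff k j hkj.1 hkj.2]
      match k, j, x, hkj with
      | 1, 0, x, hkj =>
        rw [← homotopyOp_dForm_zero hH (toCochain f₁ 1 0 x).2, hφ1 0 hkj.2, htilde hkj.2]
        simp only [dTot]
        module
      | 1, j + 1, x, hkj =>
        rw [← dForm_homotopyOp_add_homotopyOp_dForm hH (toCochain f₁ 1 (j + 1) x).2,
          hφ1 _ hkj.2, htilde hkj.2, dTot, coe_homotopyCochain, dForm_smul]
        module
      | k + 2, 0, x, hkj =>
        rw [← homotopyOp_dForm_zero hH (toCochain f₁ (k + 2) 0 x).2, hφ2 k 0 hkj.2,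
          htilde hkj.2, dTot]
        module
      | k + 2, j + 1, x, hkj =>
        rw [← dForm_homotopyOp_add_homotopyOp_dForm hH (toCochain f₁ (k + 2) (j + 1) x).2,
          hφ2 k _ hkj.2, htilde hkj.2, dTot, coe_homotopyCochain, dForm_smul, smul_smul,
          ← pow_add, Odd.neg_one_pow (n := k + 2 + (k + 2 + 1)) ⟨k + 2, by ring⟩]
        module
    · rw [(hdeg k j hkj x).1, (hdeg k j hkj x).2, tilde, dif_neg hkj, sub_zero, add_zero]
      have hc : ∀ k j, ¬(1 ≤ k ∧ k + j = n - 1) → ∀ x : Fin k → GroupLieAlgebra 𝓘(ℝ, EG) G,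
          (homotopyCochain hH (toCochain f₁) k j x : FormField E M j) = 0 := by
        intro k j h x
        rw [hη k j h]
        rfl
      match k, j, x, hkj with
      | 0, _, _, _ => rfl
      | 1, 0, _, _ => rfl
      | 1, j + 1, x, hkj => rw [dTot, hc _ _ (by omega), dForm_zero, neg_zero]
      | k + 2, 0, x, hkj =>
        simp only [dTot, hc (k + 1) 0 (by omega), dCE_zero]
      | k + 2, j + 1, x, hkj =>
        simp only [dTot, hc (k + 1) (j + 1) (by omega), hc (k + 2) j (by omega), dCE_zero,
          dForm_zero, smul_zero, add_zero]

end Equivalence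
end HomotopyMoment

open HomotopyMoment in
theorem mainTheorem7
    {E : Type*} [NormedAddCommGroup E] [NormedSpace ℝ E] [FiniteDimensional ℝ E]
    {M : Type*} [TopologicalSpace M] [T2Space M] [SecondCountableTopology M]
    [ChartedSpace E M] [IsManifold 𝓘(ℝ, E) ∞ M]
    {EG : Type*} [NormedAddCommGroup EG] [NormedSpace ℝ EG] [FiniteDimensional ℝ EG]
    {G : Type*} [TopologicalSpace G] [ChartedSpace EG G] [Group G] [LieGroup 𝓘(ℝ, EG) ∞ G]
    [MulAction G M] [ContMDiffSMul 𝓘(ℝ, EG) 𝓘(ℝ, E) ∞ G M]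
    (n : ℕ) (hn : 1 ≤ n)
    (ω₀ ω₁ : Ω E M (n + 1))
    (hω₀ : dForm (ω₀ : FormField E M (n + 1)) = 0)
    (hω₁ : dForm (ω₁ : FormField E M (n + 1)) = 0)
    (hG₀ : IsInvariantForm G (ω₀ : FormField E M (n + 1)))
    (hG₁ : IsInvariantForm G (ω₁ : FormField E M (n + 1)))
    (ψ : M ≃ₘ^∞⟮𝓘(ℝ, E), 𝓘(ℝ, E)⟯ M)
    (hψ : IsEquivariant G ψ)
    (hiso : IsEquivariantlyIsotopicToId G ψ)
    (hψω : pullback ψ (ω₁ : FormField E M (n + 1)) = (ω₀ : FormField E M (n + 1)))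
    (f₀ f₁ : BiCochain E M EG G)
    (hf₀ : IsMomentMap n (ω₀ : FormField E M (n + 1)) f₀)
    (hf₁ : IsMomentMap n (ω₁ : FormField E M (n + 1)) f₁)
    (hf : IsIntertwined n ψ f₁ f₀) :
    MomentEquivalent (ω₀ : FormField E M (n + 1)) f₀ (ω₁ : FormField E M (n + 1)) f₁ := by
  obtain ⟨Ψ, hsm, heq, hΨ0, hΨ1⟩ := hiso
  -- Reparametrizing the isotopy by a smooth step function makes it smooth on all of `ℝ × M`.
  have hmem : ∀ s, Real.smoothTransition s ∈ Set.Icc (0 : ℝ) 1 := fun s =>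
    ⟨Real.smoothTransition.nonneg s, Real.smoothTransition.le_one s⟩
  have hH : ContMDiff (𝓘(ℝ, ℝ).prod 𝓘(ℝ, E)) 𝓘(ℝ, E) ∞
      (fun q : ℝ × M => (fun s p => Ψ (Real.smoothTransition s) p) q.1 q.2) :=
    hsm.comp_contMDiff (f := fun q : ℝ × M => (Real.smoothTransition q.1, q.2))
      ((Real.smoothTransition.contDiff.contMDiff.comp contMDiff_fst).prodMk contMDiff_snd)
      fun q => ⟨hmem q.1, Set.mem_univ _⟩
  have h1 : (fun p => Ψ (Real.smoothTransition 1) p) = ψ := by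
    funext p
    rw [Real.smoothTransition.one, hΨ1]
  refine momentEquivalent_of_homotopy (H := fun s p => Ψ (Real.smoothTransition s) p) hH
    (fun s g p => heq _ (hmem s) g p) (fun p => ?_) hω₁ hG₁ ?_ hf₀.degree hf₁ ?_
  · simp only [Real.smoothTransition.zero, hΨ0]
  · rw [h1, hψω]
  · rw [h1]
    exact hf
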